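/- Let $n\in\{2,3\}$ and let $D\subset\mathbb{R}^n$ be a bounded open set satisfying the (interior) cone condition: there is a finite cone such that every $x\in D$ is the vertex of a congruent cone contained in $D$ (this holds, in particular, for every bounded Lipschitz domain). For $s>0$, write $m=\lfloor s\rfloor$ and $\sigma=s-m$, and let $H^s(D)$ be the space of real-valued functions $v$ on $D$ with weak derivatives $\partial^\alpha v$, $|\alpha|\le m$, and finite norm $$\|v\|_{s,D}^2=\sum_{|\alpha|\le m}\|\partial^\alpha v\|_{L^2(D)}^2+\sum_{|\alpha|=m}\int_D\int_D\frac{|\partial^\alpha v(x)-\partial^\alpha v(y)|^2}{|x-y|^{n+2\sigma}}\,dy\,dx,$$ where the last sum is omitted if $\sigma=0$. For measurable $\Omega\subset D$ write $\|v\|_{0,\Omega}=\|v\|_{L^2(\Omega)}$, let $|\Omega|$ be the Lebesgue measure of $\Omega$, and set $$\theta=\min\left(\frac{s}{n},\frac12\right),\qquad \eta(\Omega)=\begin{cases}|\ln|\Omega||^{1/2}&\text{if } s=n/2,\\ 1&\text{otherwise.}\end{cases}$$ Then for every $s>0$ and every $\delta>0$ there is a constant $C>0$, independent of $v$ and $\Omega$,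 such that $$\|v\|_{0,\Omega}\le C\,|\Omega|^{\theta}\,\eta(\Omega)\,\|v\|_{s,D}$$ for every $v\in H^s(D)$ and every measurable $\Omega\subset D$, where in the critical case $s=n/2$ only sets $\Omega$ with $\bigl||\Omega|-1\bigr|\ge\delta$ are considered. (If $|\Omega|=0$, the right-hand side is read as $0$.) In the other cases there is no restriction on $\Omega$, so $\delta$ plays no role. -/

import Mathlib

open MeasureTheory
open scoped ENNReal ContDiff

noncomputable section

namespace SmallDomain

/-- The classical partial derivative in the `i`-th coordinate direction. -/
def partialDeriv {n : ℕ} (i : Fin n) (φ : EuclideanSpace ℝ (Fin n) → ℝ) :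
    EuclideanSpace ℝ (Fin n) → ℝ :=
  fun x => fderiv ℝ φ x (EuclideanSpace.single i 1)

/-- The classical derivative `∂₁^{α₁} ⋯ ∂ₙ^{αₙ} φ` for a multi-index `α`. -/
def multiDeriv {n : ℕ} (α : Fin n → ℕ) (φ : EuclideanSpace ℝ (Fin n) → ℝ) :
    EuclideanSpace ℝ (Fin n) → ℝ :=
  (List.finRange n).foldr (fun i ψ => (partialDeriv i)^[α i] ψ) φ

/-- `w` is the weak derivative of order `α` of `v` in the open set `D`: both are locally
integrable in `D` and `∫_D v ∂^α φ = (-1)^{|α|} ∫_D w φ` for all `φ ∈ C_c^∞(D)`. -/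
def HasWeakDeriv {n : ℕ} (D : Set (EuclideanSpace ℝ (Fin n))) (α : Fin n → ℕ)
    (v w : EuclideanSpace ℝ (Fin n) → ℝ) : Prop :=
  LocallyIntegrableOn v D volume ∧ LocallyIntegrableOn w D volume ∧
    ∀ φ : EuclideanSpace ℝ (Fin n) → ℝ,
      ContDiff ℝ ∞ φ → HasCompactSupport φ → tsupport φ ⊆ D →
        ∫ x in D, v x * multiDeriv α φ x = (-1) ^ (∑ i, α i) * ∫ x in D, w x * φ x

open Classical in
/-- The weak derivative of order `α` of `v` in `D` (a representative of it, which is unique up to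
null sets), and `0` if there is none. -/
def weakDeriv {n : ℕ} (D : Set (EuclideanSpace ℝ (Fin n))) (α : Fin n → ℕ)
    (v : EuclideanSpace ℝ (Fin n) → ℝ) : EuclideanSpace ℝ (Fin n) → ℝ :=
  if h : ∃ w, HasWeakDeriv D α v w then h.choose else 0

/-- The squared Gagliardo (Slobodeckij) seminorm
`∫_D ∫_D |w(x) - w(y)|² / |x - y|^{n + 2σ} dy dx`. -/
def gagliardoSq {n : ℕ} (D : Set (EuclideanSpace ℝ (Fin n))) (σ : ℝ)
    (w : EuclideanSpace ℝ (Fin n) → ℝ) : ℝ≥0∞ :=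
  ∫⁻ x in D, ∫⁻ y in D, ENNReal.ofReal (|w x - w y| ^ 2 / ‖x - y‖ ^ ((n : ℝ) + 2 * σ))

/-- The norm `‖v‖_{s,D}` of `H^s(D) = W^{s,2}(D)`. With `m = ⌊s⌋` and `σ = s - m`, its square is
the sum of `‖D^α v‖²_{0,D}` over `|α| ≤ m` plus, if `σ > 0`, the sum over `|α| = m` of the squared
Gagliardo seminorms of order `σ` of `D^α v`. The multi-indices with `|α| = k` are those in
`Finset.piAntidiag Finset.univ k`. -/
def sobolevNorm {n : ℕ} (D : Set (EuclideanSpace ℝ (Fin n))) (s : ℝ)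
    (v : EuclideanSpace ℝ (Fin n) → ℝ) : ℝ≥0∞ :=
  ((∑ k ∈ Finset.range (⌊s⌋₊ + 1), ∑ α ∈ Finset.piAntidiag (Finset.univ : Finset (Fin n)) k,
      eLpNorm (weakDeriv D α v) 2 (volume.restrict D) ^ 2) +
    (if Int.fract s = 0 then 0 else
      ∑ α ∈ Finset.piAntidiag (Finset.univ : Finset (Fin n)) ⌊s⌋₊,
        gagliardoSq D (Int.fract s) (weakDeriv D α v))) ^ (1 / 2 : ℝ)

/-- `v ∈ H^s(D)`, for `s ≥ 0`: the weak derivatives of order at most `⌊s⌋` exist and the norm is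
finite. -/
def MemSobolev {n : ℕ} (D : Set (EuclideanSpace ℝ (Fin n))) (s : ℝ)
    (v : EuclideanSpace ℝ (Fin n) → ℝ) : Prop :=
  (∀ α : Fin n → ℕ, ∑ i, α i ≤ ⌊s⌋₊ → ∃ w, HasWeakDeriv D α v w) ∧ sobolevNorm D s v < ⊤

/-- The (interior) cone condition: there is a finite cone such that each point of `D` is the vertex
of a congruent cone contained in `D`. Here `r` is the height, `ξ` the axis, and `c` the cosine of
the angle between the axis and the lateral surface. -/
def ConeCondition {n : ℕ} (D : Set (EuclideanSpace ℝ (Fin n))) : Prop :=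
  ∃ r c : ℝ, 0 < r ∧ 0 < c ∧ c < 1 ∧ ∀ x ∈ D, ∃ ξ : EuclideanSpace ℝ (Fin n), ‖ξ‖ = 1 ∧
    ∀ y : EuclideanSpace ℝ (Fin n), ‖y‖ < r → c * ‖y‖ ≤ inner ℝ ξ y → x + y ∈ D

/-- The exponent `θ = min(s/n, 1/2)`. -/
def theta (n : ℕ) (s : ℝ) : ℝ := min (s / n) (1 / 2)

open Classical in
/-- The factor `η`, as a function of the measure `a = |Ω|`. -/
def eta (n : ℕ) (s a : ℝ) : ℝ :=
  if (n = 2 ∨ n = 3) ∧ s = n / 2 then |Real.log a| ^ (1 / 2 : ℝ) else 1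

end SmallDomain

end

/-! Write `a` for the measure of Ω. The cone condition provides at each `x` in D a smooth weight of
mass one whose dilates by every factor below 2, placed at `x`, stay inside D. The means of `v`
against the dilates at scales `2^{-k}` converge to `v x` for almost every `x` (Lebesgue
differentiation), so `v x` is its mean at scale 1 plus a telescoping sum of differences between
consecutive scales.

These differences are controlled by smoothness. The derivative of a dilated weight in the scale is a
divergence of dilated weights, so integration by parts turns the scale derivative of a mean of `v`
into means of the weak gradient; for fractional smoothness two means are compared through the double
integral of `w y - w z`. In each case (`OscBound`) the difference at scale `2^{-k}` is at most a
constant times `2^{-βk} q_k`, where `q_k` is the square root of the integral of a density Γ over a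
spherical shell of radius about `2^{-k}` around `x`, and Γ is a sum of squared derivatives or of
fractional densities whose integral over D is at most a constant times the squared Sobolev norm.
With one more derivative the exponent rises by one, by summation over the scales. The outcome is
`exists_pointwiseBound`, with `β = min s 2 - n/2`: at most two derivatives are ever used, which
suffices because `n/2 < 2`.

Two facts on the shells finish the proof. At fixed `x` they overlap at most four times, so the sum
of the `q_k^2` is bounded by the integral of Γ, uniformly in `x`. Integrated over `x`, the squares
gain the volume `2^{-nk}` of a shell, so the part of the sum with `k ≥ K` has L² norm of order
`2^{-sK}` (`lintegral_sq_tail_le`). If `s > n/2` the whole sum is bounded, and integration over Ω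
gives `a^{1/2}`. Otherwise, for `a < 1`, choose K with `2^{-K}` comparable to `a^{1/n}`: the tail
contributes `a^{s/n}`, and the head is bounded pointwise, by a multiple of `2^{(n/2-s)K}` if `s <
n/2` (geometric sum) and of `K^{1/2}`, that is `|log a|^{1/2}`, if `s = n/2` (Cauchy–Schwarz).
Multiplied by `a^{1/2}`, this is the stated rate. For `a ≥ 1` the L² norm on D suffices, and δ keeps
the logarithm away from zero. -/

namespace SmallDomain

/-! ### Commutation of classical partial derivatives -/

section MultiDeriv

variable {n : ℕ} {φ : EuclideanSpace ℝ (Fin n) → ℝ}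

theorem contDiff_partialDeriv (hφ : ContDiff ℝ ∞ φ) (i : Fin n) :
    ContDiff ℝ ∞ (partialDeriv i φ) :=
  (hφ.fderiv_right (m := ∞) (by simp)).clm_apply contDiff_const

theorem hasCompactSupport_partialDeriv (hφ : HasCompactSupport φ) (i : Fin n) :
    HasCompactSupport (partialDeriv i φ) :=
  hφ.fderiv_apply ℝ _

theorem tsupport_partialDeriv_subset (i : Fin n) :
    tsupport (partialDeriv i φ) ⊆ tsupport φ :=
  tsupport_fderiv_apply_subset ℝ _

theorem partialDeriv_comm (hφ : ContDiff ℝ ∞ φ) (i j : Fin n) :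
    partialDeriv i (partialDeriv j φ) = partialDeriv j (partialDeriv i φ) := by
  have key : ∀ (k l : Fin n) (x : EuclideanSpace ℝ (Fin n)),
      partialDeriv k (partialDeriv l φ) x =
        fderiv ℝ (fderiv ℝ φ) x (EuclideanSpace.single k 1) (EuclideanSpace.single l 1) := by
    intro k l x
    have hd : DifferentiableAt ℝ (fderiv ℝ φ) x :=
      (hφ.fderiv_right (m := ∞) (by simp)).differentiable (by simp) x
    have := (hd.hasFDerivAt.clm_apply (hasFDerivAt_const (EuclideanSpace.single l (1 : ℝ)) x)).fderiv
    unfold partialDeriv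
    rw [this]
    simp
  ext x
  rw [key, key]
  exact (hφ.contDiffAt.isSymmSndFDerivAt (by
    rw [minSmoothness_of_isRCLikeNormedField]; exact WithTop.coe_le_coe.2 (le_top : (2 : ℕ∞) ≤ ⊤))) _ _

theorem contDiff_iterate_partialDeriv (hφ : ContDiff ℝ ∞ φ) (i : Fin n) (k : ℕ) :
    ContDiff ℝ ∞ ((partialDeriv i)^[k] φ) := by
  induction k with
  | zero => exact hφ
  | succ k ih => rw [Function.iterate_succ_apply']; exact contDiff_partialDeriv ih i

theorem partialDeriv_iterate_comm (hφ : ContDiff ℝ ∞ φ) (i j : Fin n) (k : ℕ) :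
    partialDeriv i ((partialDeriv j)^[k] φ) = (partialDeriv j)^[k] (partialDeriv i φ) := by
  induction k with
  | zero => rfl
  | succ k ih =>
    rw [Function.iterate_succ_apply', Function.iterate_succ_apply', ← ih,
      partialDeriv_comm (contDiff_iterate_partialDeriv hφ j k)]

theorem contDiff_foldr_partialDeriv (hφ : ContDiff ℝ ∞ φ) (α : Fin n → ℕ) (l : List (Fin n)) :
    ContDiff ℝ ∞ (l.foldr (fun i ψ => (partialDeriv i)^[α i] ψ) φ) := by
  induction l with
  | nil => exact hφ
  | cons a l ih => exact contDiff_iterate_partialDeriv ih a _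

theorem partialDeriv_foldr_comm (hφ : ContDiff ℝ ∞ φ) (α : Fin n → ℕ) (i : Fin n)
    (l : List (Fin n)) :
    partialDeriv i (l.foldr (fun i ψ => (partialDeriv i)^[α i] ψ) φ) =
      l.foldr (fun i ψ => (partialDeriv i)^[α i] ψ) (partialDeriv i φ) := by
  induction l with
  | nil => rfl
  | cons a l ih =>
    simp only [List.foldr_cons]
    rw [partialDeriv_iterate_comm (contDiff_foldr_partialDeriv hφ α l), ih]

/-- `multiDeriv` applies the coordinates in a fixed order, so the extra derivative has to be moved
past the others to the innermost place; in a list without repetition it occurs at most once. -/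
theorem foldr_partialDeriv_add_single (hφ : ContDiff ℝ ∞ φ) (α : Fin n → ℕ) (i : Fin n)
    {l : List (Fin n)} (hl : l.Nodup) :
    l.foldr (fun j ψ => (partialDeriv j)^[(α + Pi.single i 1 : Fin n → ℕ) j] ψ) φ =
      l.foldr (fun j ψ => (partialDeriv j)^[α j] ψ) (if i ∈ l then partialDeriv i φ else φ) := by
  induction l with
  | nil => rfl
  | cons a l ih =>
    rw [List.nodup_cons] at hl
    simp only [List.foldr_cons]
    rw [ih hl.2]
    by_cases h : i = a
    · subst h
      simp only [hl.1, if_false, List.mem_cons, true_or, if_true, Pi.add_apply, Pi.single_eq_same,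
        Function.iterate_succ_apply]
      rw [partialDeriv_foldr_comm hφ]
    · have h' : a ≠ i := fun e => h e.symm
      simp [h, h']

theorem multiDeriv_zero : multiDeriv 0 φ = φ := by
  unfold multiDeriv
  generalize List.finRange n = l
  induction l with
  | nil => rfl
  | cons a l ih => simp

theorem multiDeriv_add_single (hφ : ContDiff ℝ ∞ φ) (α : Fin n → ℕ) (i : Fin n) :
    multiDeriv (α + Pi.single i 1) φ = multiDeriv α (partialDeriv i φ) := by
  unfold multiDeriv
  rw [foldr_partialDeriv_add_single hφ α i (List.nodup_finRange n), if_pos (List.mem_finRange i)]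

theorem multiDeriv_single (hφ : ContDiff ℝ ∞ φ) (i : Fin n) :
    multiDeriv (Pi.single i 1) φ = partialDeriv i φ := by
  have := multiDeriv_add_single hφ 0 i
  rwa [zero_add, multiDeriv_zero] at this

end MultiDeriv

/-! ### Weak derivatives: independence of the representative, order zero, iteration -/

section WeakDeriv

variable {n : ℕ} {D : Set (EuclideanSpace ℝ (Fin n))} {α : Fin n → ℕ}
  {v w u : EuclideanSpace ℝ (Fin n) → ℝ}

theorem HasWeakDeriv.weakDeriv (h : ∃ w, HasWeakDeriv D α v w) :
    HasWeakDeriv D α v (weakDeriv D α v) := by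
  unfold SmallDomain.weakDeriv
  rw [dif_pos h]
  exact h.choose_spec

theorem locallyIntegrableOn_congr_ae (hDo : IsOpen D) (h : v =ᵐ[volume.restrict D] w)
    (hv : LocallyIntegrableOn v D) : LocallyIntegrableOn w D := by
  rw [locallyIntegrableOn_iff hDo.isLocallyClosed] at hv ⊢
  intro k hk hkc
  exact (hv k hk hkc).congr (ae_mono (Measure.restrict_mono hk le_rfl) h)

theorem HasWeakDeriv.congr_ae (hDo : IsOpen D) {v' w' : EuclideanSpace ℝ (Fin n) → ℝ}
    (h : HasWeakDeriv D α v w) (hv : v =ᵐ[volume.restrict D] v')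
    (hw : w =ᵐ[volume.restrict D] w') : HasWeakDeriv D α v' w' := by
  refine ⟨locallyIntegrableOn_congr_ae hDo hv h.1, locallyIntegrableOn_congr_ae hDo hw h.2.1, ?_⟩
  intro φ h1 h2 h3
  have := h.2.2 φ h1 h2 h3
  have ev : ∫ x in D, v x * multiDeriv α φ x = ∫ x in D, v' x * multiDeriv α φ x :=
    integral_congr_ae (hv.mul (ae_eq_refl (multiDeriv α φ)))
  have ew : ∫ x in D, w x * φ x = ∫ x in D, w' x * φ x :=
    integral_congr_ae (hw.mul (ae_eq_refl φ))
  rwa [ev, ew] at this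

/-- A weak derivative of order `0` coincides with the function almost everywhere. -/
theorem HasWeakDeriv.ae_eq_of_zero (hDo : IsOpen D) (h : HasWeakDeriv D 0 v w) :
    v =ᵐ[volume.restrict D] w := by
  have hd : LocallyIntegrableOn (fun x => v x - w x) D := h.1.sub h.2.1
  have := hDo.ae_eq_zero_of_integral_contDiff_smul_eq_zero hd ?_
  · rw [Filter.EventuallyEq, ae_restrict_iff' hDo.measurableSet]
    filter_upwards [this] with x hx hxD
    linarith [hx hxD]
  · intro g h1 h2 h3
    have e := h.2.2 g h1 h2 h3
    rw [multiDeriv_zero] at e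
    simp only [Pi.zero_apply, Finset.sum_const_zero, pow_zero, one_mul] at e
    have hint : ∀ f, LocallyIntegrableOn f D → Integrable (fun x => f x * g x) (volume.restrict D) := by
      intro f hf
      have h4 : IntegrableOn (fun x => g x * f x) (tsupport g) :=
        (hf.integrableOn_compact_subset h3 h2).continuousOn_mul h1.continuous.continuousOn h2
      have h5 : Integrable (fun x => g x * f x) := by
        rwa [integrableOn_iff_integrable_of_support_subset] at h4
        exact (Function.support_mul_subset_left g f).trans (subset_tsupport g)
      exact (h5.integrableOn (s := D)).congr (Filter.Eventually.of_forall fun x => mul_comm _ _)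
    have h6 : ∫ x in D, g x • (v x - w x) = 0 := by
      simp only [smul_eq_mul, mul_comm (g _), sub_mul]
      rw [integral_sub (hint v h.1) (hint w h.2.1), e, sub_self]
    rw [← h6, setIntegral_eq_integral_of_forall_compl_eq_zero]
    intro x hx
    rw [image_eq_zero_of_notMem_tsupport (fun hx' => hx (h3 hx')), zero_smul]

/-- The weak derivative of a weak derivative. -/
theorem HasWeakDeriv.of_add_single (i : Fin n) (h : HasWeakDeriv D α v w)
    (h' : HasWeakDeriv D (α + Pi.single i 1) v u) : HasWeakDeriv D (Pi.single i 1) w u := by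
  refine ⟨h.2.1, h'.2.1, ?_⟩
  intro φ h1 h2 h3
  have e1 := h.2.2 (partialDeriv i φ) (contDiff_partialDeriv h1 i)
    (hasCompactSupport_partialDeriv h2 i) ((tsupport_partialDeriv_subset i).trans h3)
  have e2 := h'.2.2 φ h1 h2 h3
  rw [multiDeriv_add_single h1, e1] at e2
  rw [multiDeriv_single h1]
  have hs : ∑ j, (α + Pi.single i 1 : Fin n → ℕ) j = ∑ j, α j + 1 := by
    simp [Finset.sum_add_distrib]
  rw [hs, pow_succ, mul_assoc] at e2
  have := mul_left_cancel₀ (pow_ne_zero _ (by norm_num)) e2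
  simpa using this

theorem HasWeakDeriv.integral_partialDeriv {i : Fin n} (h : HasWeakDeriv D (Pi.single i 1) v w)
    {φ : EuclideanSpace ℝ (Fin n) → ℝ} (h1 : ContDiff ℝ ∞ φ) (h2 : HasCompactSupport φ)
    (h3 : tsupport φ ⊆ D) :
    ∫ x in D, v x * partialDeriv i φ x = - ∫ x in D, w x * φ x := by
  have := h.2.2 φ h1 h2 h3
  rw [multiDeriv_single h1] at this
  simpa using this

end WeakDeriv

/-- The weighted mean of `w` over the part of `D` near `x` at scale `t`, with weight `χ`. -/
noncomputable def kernelMean {n : ℕ} (D : Set (EuclideanSpace ℝ (Fin n)))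
    (χ : EuclideanSpace ℝ (Fin n) → ℝ) (x : EuclideanSpace ℝ (Fin n))
    (w : EuclideanSpace ℝ (Fin n) → ℝ) (t : ℝ) : ℝ :=
  ∫ y in D, w y * (t⁻¹ ^ n * χ (t⁻¹ • (y - x)))

/-- `χ` is a smooth weight bounded by `M` whose support lies in the shell `r ≤ ‖z‖ ≤ 4 r` and
whose dilates by factors less than `2`, placed at `x`, are supported in `D`. -/
structure IsConeKernel {n : ℕ} (D : Set (EuclideanSpace ℝ (Fin n))) (r M : ℝ)
    (x : EuclideanSpace ℝ (Fin n)) (χ : EuclideanSpace ℝ (Fin n) → ℝ) : Prop where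
  contDiff : ContDiff ℝ ∞ χ
  hasCompactSupport : HasCompactSupport χ
  abs_le : ∀ z, |χ z| ≤ M
  le_norm : ∀ z ∈ tsupport χ, r ≤ ‖z‖
  norm_le : ∀ z ∈ tsupport χ, ‖z‖ ≤ 4 * r
  mem : ∀ z ∈ tsupport χ, ∀ t : ℝ, 0 < t → t < 2 → x + t • z ∈ D

/-! ### Cone kernels and their dilates -/

section Kernel

variable {n : ℕ} {D : Set (EuclideanSpace ℝ (Fin n))} {r M : ℝ} {x : EuclideanSpace ℝ (Fin n)}
  {χ : EuclideanSpace ℝ (Fin n) → ℝ}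

theorem IsConeKernel.nonneg (h : IsConeKernel D r M x χ) : 0 ≤ M :=
  (abs_nonneg _).trans (h.abs_le 0)

/-- The weights `z i * χ z` are those that appear when a mean is differentiated in the scale; they
must again be cone kernels for the estimates to apply to the gradient. -/
theorem IsConeKernel.coord_mul (h : IsConeKernel D r M x χ) (hr : 0 ≤ r) (i : Fin n) :
    IsConeKernel D r (4 * r * M) x (fun z => z i * χ z) := by
  have hs : tsupport (fun z : EuclideanSpace ℝ (Fin n) => z i * χ z) ⊆ tsupport χ :=
    closure_mono (Function.support_mul_subset_right _ _)
  refine ⟨?_, ?_, ?_, fun z hz => h.le_norm z (hs hz), fun z hz => h.norm_le z (hs hz),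
    fun z hz => h.mem z (hs hz)⟩
  · exact (contDiff_piLp_apply (p := 2) (i := i)).mul h.contDiff
  · exact h.hasCompactSupport.mul_left
  · intro z
    rw [abs_mul]
    by_cases hz : z ∈ tsupport χ
    · have h1 : |z i| ≤ ‖z‖ := PiLp.norm_apply_le z i
      exact mul_le_mul (h1.trans (h.norm_le z hz)) (h.abs_le z) (abs_nonneg _) (by positivity)
    · rw [image_eq_zero_of_notMem_tsupport hz]
      simpa using mul_nonneg (mul_nonneg zero_le_four hr) h.nonneg

/-- The rescaled weight. -/
noncomputable def dilate (χ : EuclideanSpace ℝ (Fin n) → ℝ) (x : EuclideanSpace ℝ (Fin n)) (t : ℝ)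
    (y : EuclideanSpace ℝ (Fin n)) : ℝ :=
  t⁻¹ ^ n * χ (t⁻¹ • (y - x))

theorem IsConeKernel.contDiff_dilate (h : IsConeKernel D r M x χ) (t : ℝ) :
    ContDiff ℝ ∞ (dilate χ x t) :=
  contDiff_const.mul (h.contDiff.comp ((contDiff_id.sub contDiff_const).const_smul t⁻¹))

theorem mem_tsupport_of_mem_tsupport_dilate {t : ℝ}
    {y : EuclideanSpace ℝ (Fin n)} (hy : y ∈ tsupport (dilate χ x t)) :
    t⁻¹ • (y - x) ∈ tsupport χ := by
  have hc : Continuous fun y : EuclideanSpace ℝ (Fin n) => t⁻¹ • (y - x) := by fun_prop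
  have : tsupport (dilate χ x t) ⊆ (fun y => t⁻¹ • (y - x)) ⁻¹' tsupport χ := by
    refine closure_minimal ?_ ((isClosed_tsupport χ).preimage hc)
    intro y hy
    apply subset_tsupport
    intro h0
    apply hy
    simp [dilate, h0]
  exact this hy

theorem IsConeKernel.tsupport_dilate_subset (h : IsConeKernel D r M x χ) {t : ℝ} (ht : 0 < t)
    (ht2 : t < 2) : tsupport (dilate χ x t) ⊆ D := by
  intro y hy
  have := h.mem _ (mem_tsupport_of_mem_tsupport_dilate hy) t ht ht2
  rwa [smul_inv_smul₀ ht.ne', add_sub_cancel] at this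

theorem IsConeKernel.hasCompactSupport_dilate (h : IsConeKernel D r M x χ) {t : ℝ} (ht : 0 < t) :
    HasCompactSupport (dilate χ x t) := by
  refine HasCompactSupport.of_support_subset_isCompact (isCompact_closedBall x (t * (4 * r))) ?_
  intro y hy
  have h1 := h.norm_le _ (mem_tsupport_of_mem_tsupport_dilate (subset_tsupport _ hy))
  rw [norm_smul, norm_inv, Real.norm_of_nonneg ht.le, inv_mul_le_iff₀ ht] at h1
  rwa [mem_closedBall_iff_norm]

theorem IsConeKernel.abs_dilate_le (h : IsConeKernel D r M x χ) {t : ℝ} (ht : 0 < t)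
    (y : EuclideanSpace ℝ (Fin n)) : |dilate χ x t y| ≤ t⁻¹ ^ n * M := by
  unfold dilate
  rw [abs_mul, abs_of_pos (by positivity)]
  exact mul_le_mul_of_nonneg_left (h.abs_le _) (by positivity)

theorem kernelMean_eq (w : EuclideanSpace ℝ (Fin n) → ℝ) (t : ℝ) :
    kernelMean D χ x w t = ∫ y in D, w y * dilate χ x t y := rfl

theorem IsConeKernel.integrable_mul_dilate (h : IsConeKernel D r M x χ)
    {w : EuclideanSpace ℝ (Fin n) → ℝ} (hw : IntegrableOn w D) {t : ℝ} (ht : 0 < t) :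
    Integrable (fun y => w y * dilate χ x t y) (volume.restrict D) := by
  refine Integrable.mul_bdd hw
    (h.contDiff_dilate t).continuous.aestronglyMeasurable
    (Filter.Eventually.of_forall fun y => h.abs_dilate_le ht y)

theorem integral_dilate_univ {t : ℝ} (ht : 0 < t) :
    ∫ y, dilate χ x t y = ∫ z, χ z := by
  unfold dilate
  rw [integral_const_mul, integral_sub_right_eq_self (fun y => χ (t⁻¹ • y)) x,
    Measure.integral_comp_inv_smul_of_nonneg volume χ ht.le, finrank_euclideanSpace,
    Fintype.card_fin, smul_eq_mul, ← mul_assoc, ← mul_pow, inv_mul_cancel₀ ht.ne', one_pow, one_mul]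

theorem IsConeKernel.integral_dilate (h : IsConeKernel D r M x χ) {t : ℝ} (ht : 0 < t)
    (ht2 : t < 2) : ∫ y in D, dilate χ x t y = ∫ z, χ z := by
  rw [← integral_dilate_univ ht, setIntegral_eq_integral_of_forall_compl_eq_zero]
  intro y hy
  exact image_eq_zero_of_notMem_tsupport fun h' => hy (h.tsupport_dilate_subset ht ht2 h')

/-- The derivative of a smooth weight in the direction of dilations. -/
theorem hasDerivAt_dilate (hχ : ContDiff ℝ ∞ χ) {t : ℝ} (ht : 0 < t)
    (y : EuclideanSpace ℝ (Fin n)) :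
    HasDerivAt (fun t => dilate χ x t y)
      (-∑ i, partialDeriv i (dilate (fun z => z i * χ z) x t) y) t := by
  set ζ := t⁻¹ • (y - x) with hζ
  have hd : HasFDerivAt χ (fderiv ℝ χ ζ) ζ := (hχ.differentiable (by simp) ζ).hasFDerivAt
  have hinv : HasDerivAt (fun t : ℝ => t⁻¹) (-(t ^ 2)⁻¹) t := hasDerivAt_inv ht.ne'
  have h1 : HasDerivAt (fun t : ℝ => χ (t⁻¹ • (y - x))) (fderiv ℝ χ ζ (-(t ^ 2)⁻¹ • (y - x))) t :=
    hd.comp_hasDerivAt t (hinv.smul_const (y - x))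
  have h2 := (hinv.pow n).mul h1
  refine h2.congr_deriv ?_
  -- Summed over `i`, this gives `t^{-n-1} (n χ + ζ · ∇χ)` at `ζ`, which is minus the scale
  -- derivative.
  have h3 : ∀ i : Fin n, partialDeriv i (dilate (fun z => z i * χ z) x t) y =
      t⁻¹ ^ n * t⁻¹ * (χ ζ + ζ i * fderiv ℝ χ ζ (EuclideanSpace.single i 1)) := by
    intro i
    have e1 : HasFDerivAt (fun y : EuclideanSpace ℝ (Fin n) => t⁻¹ • (y - x))
        (t⁻¹ • ContinuousLinearMap.id ℝ (EuclideanSpace ℝ (Fin n))) y :=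
      ((hasFDerivAt_id y).sub_const x).const_smul t⁻¹
    have e2 : HasFDerivAt (fun y => χ (t⁻¹ • (y - x))) _ y := hd.comp y e1
    have e3 : HasFDerivAt (fun y : EuclideanSpace ℝ (Fin n) => (t⁻¹ • (y - x)) i) _ y :=
      (EuclideanSpace.proj (𝕜 := ℝ) i).hasFDerivAt.comp y e1
    have e4 := ((e3.mul e2).const_mul (t⁻¹ ^ n)).fderiv
    unfold partialDeriv
    have e5 : dilate (fun z => z i * χ z) x t = fun y => t⁻¹ ^ n *
      ((t⁻¹ • (y - x)) i * χ (t⁻¹ • (y - x))) := rfl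
    rw [e5]
    erw [e4]
    simp [← hζ]
    ring
  simp only [h3]
  have h4 : ζ = ∑ i, ζ i • EuclideanSpace.single i (1 : ℝ) := by
    ext j
    simp [Finset.sum_apply, Pi.single_apply]
  have h5 : fderiv ℝ χ ζ ζ = ∑ i, ζ i * fderiv ℝ χ ζ (EuclideanSpace.single i 1) := by
    exact (congrArg (fderiv ℝ χ ζ) h4).trans (by simp [map_sum])
  have h6 : -(t ^ 2)⁻¹ • (y - x) = -t⁻¹ • ζ := by
    rw [hζ, smul_smul]; congr 1; field_simp
  rw [h6, map_smul, h5, ← Finset.mul_sum, Finset.sum_add_distrib]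
  simp only [Finset.sum_const, Finset.card_univ, Fintype.card_fin, nsmul_eq_mul, smul_eq_mul]
  -- The power rule produces the truncated exponent `n - 1`, so dimension zero is separate.
  rcases n with _ | n
  · simp
  · simp only [Nat.add_sub_cancel, Pi.pow_apply, ← inv_pow]
    rw [← hζ]
    push_cast
    ring

end Kernel

/-! ### Scale derivative of the means -/

section Derivative

variable {n : ℕ} {D : Set (EuclideanSpace ℝ (Fin n))} {r M : ℝ} {x : EuclideanSpace ℝ (Fin n)}
  {χ : EuclideanSpace ℝ (Fin n) → ℝ}

theorem partialDeriv_dilate (hχ : ContDiff ℝ ∞ χ) (i : Fin n) (t : ℝ)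
    (y : EuclideanSpace ℝ (Fin n)) :
    partialDeriv i (dilate χ x t) y = t⁻¹ ^ n * (t⁻¹ * partialDeriv i χ (t⁻¹ • (y - x))) := by
  have hd : HasFDerivAt χ (fderiv ℝ χ (t⁻¹ • (y - x))) (t⁻¹ • (y - x)) :=
    (hχ.differentiable (by simp) _).hasFDerivAt
  have e1 : HasFDerivAt (fun y : EuclideanSpace ℝ (Fin n) => t⁻¹ • (y - x))
      (t⁻¹ • ContinuousLinearMap.id ℝ (EuclideanSpace ℝ (Fin n))) y :=
    ((hasFDerivAt_id y).sub_const x).const_smul t⁻¹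
  have e2 : HasFDerivAt (fun y => χ (t⁻¹ • (y - x))) _ y := hd.comp y e1
  have e4 : fderiv ℝ (dilate χ x t) y = _ := (e2.const_mul (t⁻¹ ^ n)).fderiv
  unfold partialDeriv
  rw [e4]
  simp

/-- The means of `v` against a weight are differentiable in the scale, and the derivative is
expressed through the means of the weak gradient of `v`. -/
theorem IsConeKernel.hasDerivAt_kernelMean (h : IsConeKernel D r M x χ) (hr : 0 ≤ r)
    {v : EuclideanSpace ℝ (Fin n) → ℝ} {w : Fin n → EuclideanSpace ℝ (Fin n) → ℝ}
    (hv : IntegrableOn v D) (hw : ∀ i, HasWeakDeriv D (Pi.single i 1) v (w i))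
    {t : ℝ} (ht : 0 < t) (ht2 : t < 2) :
    HasDerivAt (fun t => kernelMean D χ x v t)
      (∑ i, kernelMean D (fun z => z i * χ z) x (w i) t) t := by
  have hk : ∀ i, IsConeKernel D r (4 * r * M) x (fun z => z i * χ z) := h.coord_mul hr
  have hb : ∀ i, ∃ B, ∀ z, ‖partialDeriv i (fun z => z i * χ z) z‖ ≤ B := fun i =>
    (contDiff_partialDeriv (hk i).contDiff i).continuous.bounded_above_of_compact_support
      (hasCompactSupport_partialDeriv (hk i).hasCompactSupport i)
  choose B hB using hb
  have hBc : ∀ i, 0 ≤ B i := fun i => (norm_nonneg _).trans (hB i 0)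
  set F' : ℝ → EuclideanSpace ℝ (Fin n) → ℝ := fun t y =>
    v y * (-∑ i, partialDeriv i (dilate (fun z => z i * χ z) x t) y) with hF'
  have hcont : ∀ i s, Continuous (partialDeriv i (dilate (fun z => z i * χ z) x s)) := fun i s =>
    (contDiff_partialDeriv ((hk i).contDiff_dilate s) i).continuous
  have hbd : ∀ i, ∀ s : ℝ, t / 2 < s → ∀ y, ‖partialDeriv i (dilate (fun z => z i * χ z) x s) y‖ ≤
      (t / 2)⁻¹ ^ n * ((t / 2)⁻¹ * B i) := by
    intro i s hs y
    have hs0 : 0 < s := (half_pos ht).trans hs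
    have hinv : s⁻¹ ≤ (t / 2)⁻¹ := inv_anti₀ (half_pos ht) hs.le
    rw [partialDeriv_dilate (hk i).contDiff, norm_mul, norm_mul, norm_pow,
      Real.norm_of_nonneg (inv_pos.2 hs0).le]
    have := hB i (s⁻¹ • (y - x))
    have := hBc i
    gcongr
  have hder : Integrable (F' t) (volume.restrict D) ∧
      HasDerivAt (fun t => ∫ y in D, v y * dilate χ x t y) (∫ y in D, F' t y) t := by
    -- Scales above `t / 2` stay away from zero, so the derivatives of the dilates have a uniform
    -- bound there and a multiple of `‖v‖` dominates.
    refine hasDerivAt_integral_of_dominated_loc_of_deriv_le (s := Set.Ioi (t / 2))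
      (bound := fun y => ‖v y‖ * ∑ i, (t / 2)⁻¹ ^ n * ((t / 2)⁻¹ * B i))
      (Ioi_mem_nhds (half_lt_self ht)) ?_ (h.integrable_mul_dilate hv ht) ?_ ?_
      (hv.norm.mul_const _) ?_
    · exact Filter.Eventually.of_forall fun s => hv.aestronglyMeasurable.mul
        (h.contDiff_dilate s).continuous.aestronglyMeasurable
    · exact hv.aestronglyMeasurable.mul
        (continuous_finsetSum _ fun i _ => hcont i t).neg.aestronglyMeasurable
    · refine Filter.Eventually.of_forall fun y s hs => ?_
      rw [hF', norm_mul, norm_neg]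
      exact mul_le_mul_of_nonneg_left
        ((norm_sum_le _ _).trans (Finset.sum_le_sum fun i _ => hbd i s hs y)) (norm_nonneg _)
    · exact Filter.Eventually.of_forall fun y s hs =>
        (hasDerivAt_dilate h.contDiff ((half_pos ht).trans hs) y).const_mul (v y)
  refine hder.2.congr_deriv ?_
  have hint : ∀ i, Integrable (fun y => v y * partialDeriv i (dilate (fun z => z i * χ z) x t) y)
      (volume.restrict D) := fun i =>
    Integrable.mul_bdd hv (hcont i t).aestronglyMeasurable
      (Filter.Eventually.of_forall fun y => hbd i t (half_lt_self ht) y)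
  have e : ∀ y, F' t y =
      -∑ i, v y * partialDeriv i (dilate (fun z => z i * χ z) x t) y := by
    intro y; simp only [hF', mul_neg, Finset.mul_sum]
  simp only [e]
  rw [integral_neg, integral_finsetSum _ fun i _ => hint i, ← Finset.sum_neg_distrib]
  refine Finset.sum_congr rfl fun i _ => ?_
  -- The dilate is an admissible test function because its support lies in D; this is what `t < 2`
  -- is for.
  rw [(hw i).integral_partialDeriv ((hk i).contDiff_dilate t) ((hk i).hasCompactSupport_dilate ht)
    ((hk i).tsupport_dilate_subset ht ht2), neg_neg]
  rfl

/-- Mean value inequality with an extended bound, so that finiteness of the local integrals of the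
density need not be checked at each point. -/
theorem enorm_sub_le_of_hasDerivAt {f f' : ℝ → ℝ} {a b : ℝ} {B : ℝ≥0∞}
    (hf : ∀ t ∈ Set.Icc a b, HasDerivAt f (f' t) t) (hB : ∀ t ∈ Set.Icc a b, ‖f' t‖ₑ ≤ B)
    {t t' : ℝ} (ht : t ∈ Set.Icc a b) (ht' : t' ∈ Set.Icc a b) :
    ‖f t - f t'‖ₑ ≤ B * ENNReal.ofReal (b - a) := by
  rcases eq_or_ne t t' with rfl | hne
  · simp
  by_cases hBt : B = ⊤
  · subst hBt
    have hab : a < b := by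
      by_contra! hab
      exact hne (le_antisymm (ht.2.trans (hab.trans ht'.1)) (ht'.2.trans (hab.trans ht.1)))
    rw [ENNReal.top_mul (by simpa using hab)]
    exact le_top
  · have hB' : ∀ s ∈ Set.Icc a b, ‖f' s‖ ≤ B.toReal := by
      intro s hs
      have := ENNReal.toReal_mono hBt (hB s hs)
      rwa [toReal_enorm] at this
    have h1 := (convex_Icc a b).norm_image_sub_le_of_norm_hasDerivWithin_le
      (fun s hs => (hf s hs).hasDerivWithinAt) hB' ht' ht
    have h2 : ‖t - t'‖ ≤ b - a := by
      rw [Real.norm_eq_abs, abs_le]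
      constructor <;> linarith [ht.1, ht.2, ht'.1, ht'.2]
    rw [← ofReal_norm]
    calc ENNReal.ofReal ‖f t - f t'‖ ≤ ENNReal.ofReal (B.toReal * (b - a)) :=
          ENNReal.ofReal_le_ofReal (h1.trans (mul_le_mul_of_nonneg_left h2 ENNReal.toReal_nonneg))
      _ = B * ENNReal.ofReal (b - a) := by
          rw [ENNReal.ofReal_mul ENNReal.toReal_nonneg, ENNReal.ofReal_toReal hBt]

end Derivative

/-! ### Arithmetic of dyadic factors -/

section Scale

/-- The dyadic scale factor `2 ^ (-β k)`. -/
noncomputable def scale (β : ℝ) (k : ℕ) : ℝ≥0∞ := ENNReal.ofReal ((2 : ℝ) ^ (-(β * k)))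

theorem scale_ne_top (β : ℝ) (k : ℕ) : scale β k ≠ ⊤ := ENNReal.ofReal_ne_top

theorem scale_zero_right (β : ℝ) : scale β 0 = 1 := by simp [scale]

theorem scale_zero_left (k : ℕ) : scale 0 k = 1 := by simp [scale]

theorem scale_mul (a b : ℝ) (k : ℕ) : scale a k * scale b k = scale (a + b) k := by
  unfold scale
  rw [← ENNReal.ofReal_mul (by positivity), ← Real.rpow_add two_pos]
  congr 2; ring

theorem scale_add (a : ℝ) (j k : ℕ) : scale a (j + k) = scale a j * scale a k := by
  unfold scale
  rw [← ENNReal.ofReal_mul (by positivity), ← Real.rpow_add two_pos]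
  congr 2; push_cast; ring

theorem scale_rpow (a p : ℝ) (k : ℕ) : scale a k ^ p = scale (a * p) k := by
  unfold scale
  rw [ENNReal.ofReal_rpow_of_pos (by positivity), ← Real.rpow_mul zero_le_two]
  congr 2; ring

theorem scale_eq_pow (a : ℝ) (k : ℕ) : scale a k = scale a 1 ^ k := by
  unfold scale
  rw [← ENNReal.ofReal_pow (by positivity), ← Real.rpow_natCast, ← Real.rpow_mul zero_le_two]
  congr 2; push_cast; ring

theorem two_inv_pow_eq (k : ℕ) : ((1 : ℝ) / 2) ^ k = (2 : ℝ) ^ (-(k : ℝ)) := by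
  rw [Real.rpow_neg zero_le_two, Real.rpow_natCast, one_div, inv_pow]

theorem ofReal_half_pow (k : ℕ) : ENNReal.ofReal (((1 : ℝ) / 2) ^ k) = scale 1 k := by
  rw [two_inv_pow_eq, scale, one_mul]

theorem scale_lt_one {a : ℝ} (ha : 0 < a) : scale a 1 < 1 := by
  unfold scale
  rw [ENNReal.ofReal_lt_one]
  exact Real.rpow_lt_one_of_one_lt_of_neg one_lt_two (by simpa using ha)

theorem scale_anti {a b : ℝ} (h : a ≤ b) (k : ℕ) : scale b k ≤ scale a k := by
  unfold scale
  apply ENNReal.ofReal_le_ofReal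
  apply Real.rpow_le_rpow_of_exponent_le one_le_two
  have : a * k ≤ b * k := mul_le_mul_of_nonneg_right h k.cast_nonneg
  linarith

theorem tsum_scale (a : ℝ) : ∑' k, scale a k = (1 - scale a 1)⁻¹ := by
  rw [← ENNReal.tsum_geometric]
  exact tsum_congr fun k => scale_eq_pow a k

theorem tsum_scale_ne_top {a : ℝ} (ha : 0 < a) : ∑' k, scale a k ≠ ⊤ := by
  rw [tsum_scale, ENNReal.inv_ne_top]
  exact (tsub_pos_of_lt (scale_lt_one ha)).ne'

end Scale

/-! ### Dyadic shells and the supports of the dilates -/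

section Shell

variable {n : ℕ}

/-- The closed dyadic spherical shell of index `k` around `x`. -/
def shell (r : ℝ) (x : EuclideanSpace ℝ (Fin n)) (k : ℕ) : Set (EuclideanSpace ℝ (Fin n)) :=
  {y | r / 2 * (1 / 2) ^ k ≤ ‖y - x‖ ∧ ‖y - x‖ ≤ 4 * r * (1 / 2) ^ k}

theorem measurableSet_shell (r : ℝ) (x : EuclideanSpace ℝ (Fin n)) (k : ℕ) :
    MeasurableSet (shell r x k) := by
  have h : Measurable fun y : EuclideanSpace ℝ (Fin n) => ‖y - x‖ := by fun_prop
  exact (measurableSet_le measurable_const h).inter (measurableSet_le h measurable_const)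

theorem volume_shell_le {r : ℝ} (hr : 0 ≤ r) (x : EuclideanSpace ℝ (Fin n)) (k : ℕ) :
    volume (shell r x k) ≤
      scale n k * volume (Metric.closedBall (0 : EuclideanSpace ℝ (Fin n)) (4 * r)) := by
  calc volume (shell r x k) ≤ volume (Metric.closedBall x ((1 / 2) ^ k * (4 * r))) := by
        refine measure_mono fun y hy => ?_
        rw [mem_closedBall_iff_norm]
        exact hy.2.trans_eq (mul_comm _ _)
    _ = _ := by
        rw [Measure.addHaar_closedBall_mul volume x (by positivity) (by positivity),
          finrank_euclideanSpace, Fintype.card_fin, ENNReal.ofReal_pow (by positivity),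
          ofReal_half_pow, ← ENNReal.rpow_natCast, scale_rpow, one_mul]

/-- The kernel lives in `r ≤ ‖z‖ ≤ 4 r` and `t` varies over a full dyadic interval, whose lower end
costs a factor two: hence the inner radius `r / 2` in `shell`. -/
theorem IsConeKernel.mem_shell {D : Set (EuclideanSpace ℝ (Fin n))} {r M : ℝ}
    {x : EuclideanSpace ℝ (Fin n)} {χ : EuclideanSpace ℝ (Fin n) → ℝ} (h : IsConeKernel D r M x χ)
    (hr : 0 ≤ r) {k : ℕ} {t : ℝ} (ht : t ∈ Set.Icc ((1 / 2 : ℝ) ^ (k + 1)) ((1 / 2) ^ k))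
    {y : EuclideanSpace ℝ (Fin n)} (hy : dilate χ x t y ≠ 0) : y ∈ shell r x k := by
  have ht0 : 0 < t := lt_of_lt_of_le (by positivity) ht.1
  have hy' := mem_tsupport_of_mem_tsupport_dilate (subset_tsupport _ hy)
  have h1 := h.le_norm _ hy'
  have h2 := h.norm_le _ hy'
  rw [norm_smul, norm_inv, Real.norm_of_nonneg ht0.le] at h1 h2
  rw [inv_mul_le_iff₀ ht0] at h2
  rw [le_inv_mul_iff₀ ht0] at h1
  constructor
  · refine le_trans ?_ h1
    calc r / 2 * (1 / 2) ^ k = (1 / 2) ^ (k + 1) * r := by ring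
      _ ≤ t * r := mul_le_mul_of_nonneg_right ht.1 hr
  · refine h2.trans ?_
    rw [mul_comm]
    exact mul_le_mul_of_nonneg_left ht.2 (by positivity)

theorem IsConeKernel.enorm_dilate_le {D : Set (EuclideanSpace ℝ (Fin n))} {r M : ℝ}
    {x : EuclideanSpace ℝ (Fin n)} {χ : EuclideanSpace ℝ (Fin n) → ℝ} (h : IsConeKernel D r M x χ)
    {k : ℕ} {t : ℝ} (ht : (1 / 2 : ℝ) ^ (k + 1) ≤ t) (y : EuclideanSpace ℝ (Fin n)) :
    ‖dilate χ x t y‖ₑ ≤ ENNReal.ofReal M * (2 ^ n * scale (-n) k) := by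
  have ht0 : 0 < t := lt_of_lt_of_le (by positivity) ht
  have h1 := h.abs_dilate_le ht0 y
  have h2 : t⁻¹ ≤ 2 * 2 ^ k := by
    refine (inv_anti₀ (by positivity) ht).trans_eq ?_
    rw [one_div, inv_pow, inv_inv, pow_succ, mul_comm]
  have h3 : t⁻¹ ^ n * M ≤ M * (2 ^ n * (2 ^ k) ^ n) := by
    rw [mul_comm, ← mul_pow]
    have := h.nonneg
    gcongr
  rw [← ofReal_norm]
  refine (ENNReal.ofReal_le_ofReal (h1.trans h3)).trans_eq ?_
  have h4 : ((2 : ℝ) ^ k) ^ n = 2 ^ (-(-(n : ℝ) * k)) := by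
    rw [neg_mul, neg_neg, ← Nat.cast_mul, Real.rpow_natCast, ← pow_mul, mul_comm]
  rw [ENNReal.ofReal_mul h.nonneg, ENNReal.ofReal_mul (by positivity), h4, scale,
    ENNReal.ofReal_pow zero_le_two, ENNReal.ofReal_ofNat]

theorem setLIntegral_le_sqrt_mul {α : Type*} [MeasurableSpace α] {μ : Measure α} {A : Set α}
    {f : α → ℝ≥0∞} (hf : AEMeasurable f (μ.restrict A)) :
    ∫⁻ y in A, f y ∂μ ≤ μ A ^ (1 / 2 : ℝ) * (∫⁻ y in A, f y ^ 2 ∂μ) ^ (1 / 2 : ℝ) := by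
  have := ENNReal.lintegral_mul_le_Lp_mul_Lq (μ.restrict A) Real.HolderConjugate.two_two
    (aemeasurable_const (b := (1 : ℝ≥0∞))) hf
  simpa using this

theorem rpow_half_sq (a : ℝ≥0∞) : (a ^ (1 / 2 : ℝ)) ^ 2 = a := by
  rw [← ENNReal.rpow_natCast, ← ENNReal.rpow_mul]; norm_num

theorem sq_rpow_half (a : ℝ≥0∞) : (a ^ 2) ^ (1 / 2 : ℝ) = a := by
  rw [← ENNReal.rpow_natCast, ← ENNReal.rpow_mul]; norm_num

/-- The square root of the volume of the ball that contains the shell of index `0`. -/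
noncomputable def ballConst (n : ℕ) (r : ℝ) : ℝ≥0∞ :=
  volume (Metric.closedBall (0 : EuclideanSpace ℝ (Fin n)) (4 * r)) ^ (1 / 2 : ℝ)

theorem ballConst_ne_top (n : ℕ) (r : ℝ) : ballConst n r ≠ ⊤ :=
  ENNReal.rpow_ne_top_of_nonneg (by norm_num) measure_closedBall_lt_top.ne

theorem volume_shell_sqrt_le {r : ℝ} (hr : 0 ≤ r) (x : EuclideanSpace ℝ (Fin n)) (k : ℕ)
    (D : Set (EuclideanSpace ℝ (Fin n))) :
    volume (D ∩ shell r x k) ^ (1 / 2 : ℝ) ≤ scale (n / 2) k * ballConst n r := by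
  calc volume (D ∩ shell r x k) ^ (1 / 2 : ℝ)
      ≤ (scale n k * volume (Metric.closedBall (0 : EuclideanSpace ℝ (Fin n)) (4 * r)))
        ^ (1 / 2 : ℝ) := ENNReal.rpow_le_rpow
          ((measure_mono Set.inter_subset_right).trans (volume_shell_le hr x k)) (by norm_num)
    _ = _ := by
        rw [ENNReal.mul_rpow_of_nonneg _ _ (by norm_num), scale_rpow, ballConst]
        congr 2; ring

end Shell

/-! ### Oscillation of the means between comparable scales -/

section Oscillation

variable {n : ℕ} {D : Set (EuclideanSpace ℝ (Fin n))} {r M : ℝ} {x : EuclideanSpace ℝ (Fin n)}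
  {χ : EuclideanSpace ℝ (Fin n) → ℝ}

theorem setLIntegral_mul_dilate_le (h : IsConeKernel D r M x χ) (hr : 0 ≤ r)
    {k : ℕ} {t : ℝ} (ht : t ∈ Set.Icc ((1 / 2 : ℝ) ^ (k + 1)) ((1 / 2) ^ k))
    (f : EuclideanSpace ℝ (Fin n) → ℝ≥0∞) :
    ∫⁻ y in D, f y * ‖dilate χ x t y‖ₑ ≤
      (∫⁻ y in D ∩ shell r x k, f y) * (ENNReal.ofReal M * (2 ^ n * scale (-n) k)) := by
  rw [← lintegral_mul_const' _ _ (ENNReal.mul_ne_top ENNReal.ofReal_ne_top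
    (ENNReal.mul_ne_top (by simp) (scale_ne_top _ _)))]
  rw [Set.inter_comm, ← Measure.restrict_restrict (measurableSet_shell r x k),
    ← lintegral_indicator (measurableSet_shell r x k)]
  refine lintegral_mono fun y => ?_
  by_cases hy : y ∈ shell r x k
  · rw [Set.indicator_of_mem hy]
    gcongr
    exact h.enorm_dilate_le ht.1 y
  · have : dilate χ x t y = 0 := by
      by_contra h0
      exact hy (h.mem_shell hr ht h0)
    simp [this]

theorem enorm_kernelMean_le_setLIntegral (h : IsConeKernel D r M x χ)
    (hr : 0 ≤ r) {k : ℕ} {t : ℝ} (ht : t ∈ Set.Icc ((1 / 2 : ℝ) ^ (k + 1)) ((1 / 2) ^ k))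
    (w : EuclideanSpace ℝ (Fin n) → ℝ) :
    ‖kernelMean D χ x w t‖ₑ ≤
      (∫⁻ y in D ∩ shell r x k, ‖w y‖ₑ) * (ENNReal.ofReal M * (2 ^ n * scale (-n) k)) := by
  rw [kernelMean_eq]
  refine (enorm_integral_le_lintegral_enorm _).trans ?_
  simp only [enorm_mul]
  exact setLIntegral_mul_dilate_le h hr ht _

/-- The constant in the Cauchy--Schwarz estimate of the means. -/
noncomputable def meanConst (n : ℕ) (r : ℝ) : ℝ≥0∞ := 2 ^ n * ballConst n r

theorem meanConst_ne_top (n : ℕ) (r : ℝ) : meanConst n r ≠ ⊤ :=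
  ENNReal.mul_ne_top (by simp) (ballConst_ne_top n r)

/-- Cauchy–Schwarz on the shell: the height `2^{nk}` of the dilate times the root `2^{-nk/2}` of the
shell's volume leaves `2^{nk/2}`. -/
theorem enorm_kernelMean_le (h : IsConeKernel D r M x χ)
    (hr : 0 ≤ r) {k : ℕ} {t : ℝ} (ht : t ∈ Set.Icc ((1 / 2 : ℝ) ^ (k + 1)) ((1 / 2) ^ k))
    {w : EuclideanSpace ℝ (Fin n) → ℝ} (hw : AEMeasurable w (volume.restrict D)) :
    ‖kernelMean D χ x w t‖ₑ ≤ ENNReal.ofReal M * (meanConst n r *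
      (scale (-(n / 2)) k * (∫⁻ y in D ∩ shell r x k, ‖w y‖ₑ ^ 2) ^ (1 / 2 : ℝ))) := by
  refine (enorm_kernelMean_le_setLIntegral h hr ht w).trans ?_
  have h1 := setLIntegral_le_sqrt_mul (μ := volume) (A := D ∩ shell r x k)
    (f := fun y => ‖w y‖ₑ) (hw.mono_set Set.inter_subset_left).enorm
  set I := (∫⁻ y in D ∩ shell r x k, ‖w y‖ₑ ^ 2) ^ (1 / 2 : ℝ)
  calc _ ≤ ((scale (n / 2) k * ballConst n r) * I) *
        (ENNReal.ofReal M * (2 ^ n * scale (-n) k)) := by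
        gcongr
        refine h1.trans ?_
        gcongr
        exact volume_shell_sqrt_le hr x k D
    _ = ENNReal.ofReal M * (2 ^ n * ballConst n r * ((scale (n / 2) k * scale (-n) k) * I)) := by
        ring
    _ = _ := by rw [scale_mul, meanConst]; congr 4; ring

theorem enorm_kernelMean_one_le (h : IsConeKernel D r M x χ)
    (hr : 0 ≤ r) {w : EuclideanSpace ℝ (Fin n) → ℝ} (hw : AEMeasurable w (volume.restrict D)) :
    ‖kernelMean D χ x w 1‖ₑ ≤ ENNReal.ofReal M * (meanConst n r *
      (∫⁻ y in D, ‖w y‖ₑ ^ 2) ^ (1 / 2 : ℝ)) := by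
  have := enorm_kernelMean_le h hr (k := 0) (t := 1) (by norm_num) hw
  refine this.trans ?_
  rw [scale_zero_right, one_mul]
  gcongr
  exact Set.inter_subset_left

/-- The means of `w` over weights at `x` vary by at most `C 2^{-βk} q_k` between scales that are
comparable to `2^{-k}`. -/
def OscBound (D : Set (EuclideanSpace ℝ (Fin n))) (r : ℝ) (x : EuclideanSpace ℝ (Fin n))
    (C : ℝ≥0∞) (β : ℝ) (w : EuclideanSpace ℝ (Fin n) → ℝ) (q : ℕ → ℝ≥0∞) : Prop :=
  ∀ χ M, IsConeKernel D r M x χ → ∀ k : ℕ,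
    ∀ t ∈ Set.Icc ((1 / 2 : ℝ) ^ (k + 1)) ((1 / 2) ^ k),
      ∀ t' ∈ Set.Icc ((1 / 2 : ℝ) ^ (k + 1)) ((1 / 2) ^ k),
        ‖kernelMean D χ x w t - kernelMean D χ x w t'‖ₑ ≤
          C * (ENNReal.ofReal M * (scale β k * q k))

theorem half_pow_mem_Icc (k : ℕ) :
    (1 / 2 : ℝ) ^ k ∈ Set.Icc ((1 / 2 : ℝ) ^ (k + 1)) ((1 / 2) ^ k) :=
  ⟨pow_le_pow_of_le_one (by norm_num) (by norm_num) k.le_succ, le_rfl⟩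

theorem half_pow_succ_mem_Icc (k : ℕ) :
    (1 / 2 : ℝ) ^ (k + 1) ∈ Set.Icc ((1 / 2 : ℝ) ^ (k + 1)) ((1 / 2) ^ k) :=
  ⟨le_rfl, pow_le_pow_of_le_one (by norm_num) (by norm_num) k.le_succ⟩

theorem pos_of_mem_Icc_half_pow {k : ℕ} {t : ℝ}
    (ht : t ∈ Set.Icc ((1 / 2 : ℝ) ^ (k + 1)) ((1 / 2) ^ k)) : 0 < t :=
  lt_of_lt_of_le (by positivity) ht.1

theorem lt_two_of_mem_Icc_half_pow {k : ℕ} {t : ℝ}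
    (ht : t ∈ Set.Icc ((1 / 2 : ℝ) ^ (k + 1)) ((1 / 2) ^ k)) : t < 2 :=
  (ht.2.trans (pow_le_one₀ (by norm_num) (by norm_num))).trans_lt one_lt_two

theorem half_pow_sub_le (k : ℕ) :
    ENNReal.ofReal ((1 / 2 : ℝ) ^ k - (1 / 2) ^ (k + 1)) ≤ scale 1 k := by
  rw [← ofReal_half_pow]
  apply ENNReal.ofReal_le_ofReal
  have : (0 : ℝ) ≤ (1 / 2) ^ (k + 1) := by positivity
  linarith

/-- A function with a square-integrable weak gradient satisfies an oscillation bound. -/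
theorem oscBound_of_gradient (hr : 0 ≤ r)
    {v : EuclideanSpace ℝ (Fin n) → ℝ} {w : Fin n → EuclideanSpace ℝ (Fin n) → ℝ}
    (hv : IntegrableOn v D) (hw : ∀ i, HasWeakDeriv D (Pi.single i 1) v (w i))
    {Γ : EuclideanSpace ℝ (Fin n) → ℝ≥0∞} (hΓ : ∀ i y, ‖w i y‖ₑ ^ 2 ≤ Γ y) :
    OscBound D r x (n * (ENNReal.ofReal (4 * r) * meanConst n r)) (1 - n / 2) v
      (fun k => (∫⁻ y in D ∩ shell r x k, Γ y) ^ (1 / 2 : ℝ)) := by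
  intro χ M hχ k t ht t' ht'
  have hwm : ∀ i, AEMeasurable (w i) (volume.restrict D) := fun i =>
    (hw i).2.1.aestronglyMeasurable.aemeasurable
  set q := (∫⁻ y in D ∩ shell r x k, Γ y) ^ (1 / 2 : ℝ)
  have hB : ∀ s ∈ Set.Icc ((1 / 2 : ℝ) ^ (k + 1)) ((1 / 2) ^ k),
      ‖∑ i, kernelMean D (fun z => z i * χ z) x (w i) s‖ₑ ≤
        n * (ENNReal.ofReal (4 * r * M) * (meanConst n r * (scale (-(n / 2)) k * q))) := by
    intro s hs
    refine (enorm_sum_le _ _).trans ((Finset.sum_le_card_nsmul _ _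
      (ENNReal.ofReal (4 * r * M) * (meanConst n r * (scale (-(n / 2)) k * q))) fun i _ =>
      ((enorm_kernelMean_le (hχ.coord_mul hr i) hr hs (hwm i)).trans ?_)).trans_eq ?_)
    · gcongr
      exact ENNReal.rpow_le_rpow (lintegral_mono fun y => hΓ i y) (by norm_num)
    · simp [nsmul_eq_mul]
  -- The length of the scale interval, at most `2^{-k}`, supplies the 1 in the exponent `1 - n / 2`.
  have h1 := enorm_sub_le_of_hasDerivAt (fun s hs => hχ.hasDerivAt_kernelMean hr hv hw
    (pos_of_mem_Icc_half_pow hs) (lt_two_of_mem_Icc_half_pow hs)) hB ht ht'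
  refine h1.trans ?_
  calc _ ≤ n * (ENNReal.ofReal (4 * r * M) * (meanConst n r * (scale (-(n / 2)) k * q)))
        * scale 1 k := by gcongr; exact half_pow_sub_le k
    _ = n * (ENNReal.ofReal (4 * r) * meanConst n r) *
        (ENNReal.ofReal M * ((scale 1 k * scale (-(n / 2)) k) * q)) := by
        rw [ENNReal.ofReal_mul (by positivity)]; ring
    _ = _ := by rw [scale_mul, ← sub_eq_add_neg]

/-- The fractional density of `w`, whose integral over `D` is the squared Gagliardo seminorm. -/
noncomputable def gagliardoDensity (D : Set (EuclideanSpace ℝ (Fin n))) (σ : ℝ)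
    (w : EuclideanSpace ℝ (Fin n) → ℝ) (y : EuclideanSpace ℝ (Fin n)) : ℝ≥0∞ :=
  ∫⁻ z in D, ENNReal.ofReal (|w y - w z| ^ 2 / ‖y - z‖ ^ ((n : ℝ) + 2 * σ))

theorem enorm_sub_sq_le_of_mem_shell (hr : 0 < r) {σ : ℝ} (hσ : 0 ≤ σ)
    (w : EuclideanSpace ℝ (Fin n) → ℝ) {k : ℕ} {y z : EuclideanSpace ℝ (Fin n)}
    (hy : y ∈ shell r x k) (hz : z ∈ shell r x k) :
    ‖w y - w z‖ₑ ^ 2 ≤ ENNReal.ofReal ((8 * r) ^ ((n : ℝ) + 2 * σ)) * scale (n + 2 * σ) k *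
      ENNReal.ofReal (|w y - w z| ^ 2 / ‖y - z‖ ^ ((n : ℝ) + 2 * σ)) := by
  rcases eq_or_ne y z with rfl | hne
  · simp
  have hpos : 0 < ‖y - z‖ := norm_pos_iff.2 (sub_ne_zero.2 hne)
  have h1 : ‖y - z‖ ≤ 8 * r * (1 / 2) ^ k := by
    calc ‖y - z‖ = ‖(y - x) - (z - x)‖ := by rw [sub_sub_sub_cancel_right]
      _ ≤ ‖y - x‖ + ‖z - x‖ := norm_sub_le _ _
      _ ≤ _ := by linarith [hy.2, hz.2]
  have h2 : ‖y - z‖ ^ ((n : ℝ) + 2 * σ) ≤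
      (8 * r) ^ ((n : ℝ) + 2 * σ) * 2 ^ (-(((n : ℝ) + 2 * σ) * k)) := by
    refine (Real.rpow_le_rpow hpos.le h1 (by positivity)).trans_eq ?_
    rw [Real.mul_rpow (by positivity) (by positivity), two_inv_pow_eq,
      ← Real.rpow_mul zero_le_two]
    congr 2; ring
  rw [scale, ← ENNReal.ofReal_mul (by positivity), ← ENNReal.ofReal_mul (by positivity),
    ← ofReal_norm, ← ENNReal.ofReal_pow (norm_nonneg _), Real.norm_eq_abs]
  apply ENNReal.ofReal_le_ofReal
  rw [mul_div_assoc', le_div_iff₀ (by positivity), mul_comm]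
  exact mul_le_mul_of_nonneg_right h2 (by positivity)

/-- The constant in the oscillation bound for functions of fractional smoothness. -/
noncomputable def fracConst (n : ℕ) (r σ M₀ : ℝ) : ℝ≥0∞ :=
  2 * (ENNReal.ofReal M₀ * (meanConst n r * meanConst n r *
    ENNReal.ofReal ((8 * r) ^ ((n : ℝ) + 2 * σ)) ^ (1 / 2 : ℝ)))

theorem fracConst_ne_top (n : ℕ) (r σ M₀ : ℝ) : fracConst n r σ M₀ ≠ ⊤ := by
  unfold fracConst
  exact ENNReal.mul_ne_top (by simp) (ENNReal.mul_ne_top (by simp) (ENNReal.mul_ne_top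
    (ENNReal.mul_ne_top (meanConst_ne_top _ _) (meanConst_ne_top _ _))
    (ENNReal.rpow_ne_top_of_nonneg (by norm_num) (by simp))))

/-- Cauchy–Schwarz in each variable, and then the Gagliardo kernel is inserted: two points of one
shell are at distance at most `8 r 2^{-k}`, so its denominator costs only a power of the scale. -/
theorem setLIntegral_setLIntegral_enorm_sub_le (hD : MeasurableSet D) (hr : 0 < r) {σ : ℝ}
    (hσ : 0 ≤ σ) {w : EuclideanSpace ℝ (Fin n) → ℝ} (hw : Measurable w) (k : ℕ) :
    ∫⁻ y in D ∩ shell r x k, ∫⁻ z in D ∩ shell r x k, ‖w y - w z‖ₑ ≤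
      (scale (n / 2) k * ballConst n r) * ((scale (n / 2) k * ballConst n r) *
      ((ENNReal.ofReal ((8 * r) ^ ((n : ℝ) + 2 * σ)) * scale (n + 2 * σ) k) ^ (1 / 2 : ℝ) *
        (∫⁻ y in D ∩ shell r x k, gagliardoDensity D σ w y) ^ (1 / 2 : ℝ))) := by
  set A := D ∩ shell r x k with hA
  have hAm : MeasurableSet A := hD.inter (measurableSet_shell r x k)
  set c := scale (n / 2) k * ballConst n r with hc
  have hcA : volume A ^ (1 / 2 : ℝ) ≤ c := volume_shell_sqrt_le hr.le x k D
  have hm : Measurable fun p : EuclideanSpace ℝ (Fin n) × EuclideanSpace ℝ (Fin n) =>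
      ‖w p.1 - w p.2‖ₑ := by fun_prop
  have hcn : c ≠ ⊤ := ENNReal.mul_ne_top (scale_ne_top _ _) (ballConst_ne_top _ _)
  have hm2 : Measurable fun y => ∫⁻ z in A, ‖w y - w z‖ₑ ^ 2 :=
    (hm.pow_const 2).lintegral_prod_right'
  calc ∫⁻ y in A, ∫⁻ z in A, ‖w y - w z‖ₑ
      ≤ ∫⁻ y in A, c * (∫⁻ z in A, ‖w y - w z‖ₑ ^ 2) ^ (1 / 2 : ℝ) := by
        refine lintegral_mono fun y => ?_
        refine (setLIntegral_le_sqrt_mul (by fun_prop)).trans ?_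
        gcongr
    _ = c * ∫⁻ y in A, (∫⁻ z in A, ‖w y - w z‖ₑ ^ 2) ^ (1 / 2 : ℝ) :=
        lintegral_const_mul' _ _ hcn
    _ ≤ c * (c * (∫⁻ y in A, ∫⁻ z in A, ‖w y - w z‖ₑ ^ 2) ^ (1 / 2 : ℝ)) := by
        gcongr
        refine (setLIntegral_le_sqrt_mul (hm2.pow_const _).aemeasurable).trans ?_
        simp only [rpow_half_sq]
        gcongr
    _ ≤ _ := by
        rw [← ENNReal.mul_rpow_of_nonneg _ _ (by norm_num)]
        gcongr
        rw [← lintegral_const_mul' _ _ (ENNReal.mul_ne_top ENNReal.ofReal_ne_top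
          (scale_ne_top _ _))]
        refine setLIntegral_mono' hAm fun y hy => ?_
        unfold gagliardoDensity
        rw [← lintegral_const_mul' _ _ (ENNReal.mul_ne_top ENNReal.ofReal_ne_top
          (scale_ne_top _ _))]
        refine (setLIntegral_mono' hAm fun z hz =>
          enorm_sub_sq_le_of_mem_shell hr hσ w hy.2 hz.2).trans ?_
        exact lintegral_mono_set Set.inter_subset_left

/-- A function of fractional smoothness satisfies an oscillation bound. -/
theorem oscBound_of_gagliardo (hD : MeasurableSet D) (hr : 0 < r) {σ : ℝ} (hσ : 0 ≤ σ)
    {w : EuclideanSpace ℝ (Fin n) → ℝ} (hwi : IntegrableOn w D) (hw : Measurable w)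
    {M₀ : ℝ} {ψ : EuclideanSpace ℝ (Fin n) → ℝ} (hψ : IsConeKernel D r M₀ x ψ)
    (hψ1 : ∫ z, ψ z = 1) :
    OscBound D r x (fracConst n r σ M₀) (σ - n / 2) w
      (fun k => (∫⁻ y in D ∩ shell r x k, gagliardoDensity D σ w y) ^ (1 / 2 : ℝ)) := by
  intro χ M hχ k t ht t' ht'
  set q := (∫⁻ y in D ∩ shell r x k, gagliardoDensity D σ w y) ^ (1 / 2 : ℝ) with hq
  set m := kernelMean D ψ x w ((1 / 2) ^ k) with hm
  set B := ENNReal.ofReal M₀ * (meanConst n r * meanConst n r *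
    ENNReal.ofReal ((8 * r) ^ ((n : ℝ) + 2 * σ)) ^ (1 / 2 : ℝ)) *
      (ENNReal.ofReal M * (scale (σ - n / 2) k * q)) with hB
  have hk0 := half_pow_mem_Icc k
  have hψD : Integrable (dilate ψ x ((1 / 2) ^ k)) (volume.restrict D) :=
    ((hψ.contDiff_dilate _).continuous.integrable_of_hasCompactSupport
      (hψ.hasCompactSupport_dilate (pos_of_mem_Icc_half_pow hk0))).integrableOn
  -- The kernel χ need not have mass one, so both means are compared with `∫ χ` times the mean `m`
  -- against the unit-mass kernel ψ at the fixed scale `2^{-k}`.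
  have key : ∀ s ∈ Set.Icc ((1 / 2 : ℝ) ^ (k + 1)) ((1 / 2) ^ k),
      ‖kernelMean D χ x w s - (∫ z, χ z) * m‖ₑ ≤ B := by
    intro s hs
    have hs0 := pos_of_mem_Icc_half_pow hs
    have hχD : Integrable (dilate χ x s) (volume.restrict D) :=
      ((hχ.contDiff_dilate _).continuous.integrable_of_hasCompactSupport
        (hχ.hasCompactSupport_dilate hs0)).integrableOn
    have e1 : kernelMean D χ x w s - (∫ z, χ z) * m =
        ∫ y in D, (w y - m) * dilate χ x s y := by
      rw [← hχ.integral_dilate hs0 (lt_two_of_mem_Icc_half_pow hs), kernelMean_eq, mul_comm,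
        ← integral_const_mul, ← integral_sub (hχ.integrable_mul_dilate hwi hs0)
          (hχD.const_mul m)]
      simp only [sub_mul]
    have e2 : ∀ y, w y - m = ∫ z in D, (w y - w z) * dilate ψ x ((1 / 2) ^ k) z := by
      intro y
      have : w y = ∫ z in D, w y * dilate ψ x ((1 / 2) ^ k) z := by
        rw [integral_const_mul, hψ.integral_dilate (pos_of_mem_Icc_half_pow hk0)
          (lt_two_of_mem_Icc_half_pow hk0), hψ1, mul_one]
      simp only [sub_mul]
      rw [integral_sub (hψD.const_mul _)
        (hψ.integrable_mul_dilate hwi (pos_of_mem_Icc_half_pow hk0)), ← this, hm, kernelMean_eq]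
    have e3 : ∀ y, ‖w y - m‖ₑ ≤ (∫⁻ z in D ∩ shell r x k, ‖w y - w z‖ₑ) *
        (ENNReal.ofReal M₀ * (2 ^ n * scale (-n) k)) := by
      intro y
      rw [e2 y]
      refine (enorm_integral_le_lintegral_enorm _).trans ?_
      simp only [enorm_mul]
      exact setLIntegral_mul_dilate_le hψ hr.le hk0 fun z => ‖w y - w z‖ₑ
    rw [e1]
    refine (enorm_integral_le_lintegral_enorm _).trans ?_
    simp only [enorm_mul]
    refine (setLIntegral_mul_dilate_le hχ hr.le hs fun y => ‖w y - m‖ₑ).trans ?_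
    have e4 : ∫⁻ y in D ∩ shell r x k, ‖w y - m‖ₑ ≤
        (∫⁻ y in D ∩ shell r x k, ∫⁻ z in D ∩ shell r x k, ‖w y - w z‖ₑ) *
          (ENNReal.ofReal M₀ * (2 ^ n * scale (-n) k)) := by
      rw [← lintegral_mul_const' _ _ (ENNReal.mul_ne_top ENNReal.ofReal_ne_top
        (ENNReal.mul_ne_top (by simp) (scale_ne_top _ _)))]
      exact lintegral_mono e3
    have e5 := e4.trans (mul_le_mul_left
      (setLIntegral_setLIntegral_enorm_sub_le hD hr hσ hw k) _)
    refine (mul_le_mul_left e5 _).trans_eq ?_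
    rw [← hq, ENNReal.mul_rpow_of_nonneg _ _ (by norm_num), scale_rpow, hB]
    -- Exponents: `n/2` twice from the volumes, `n/2 + σ` from the Gagliardo kernel, and `-n` twice
    -- from the heights of the two dilates.
    have e6 : scale (σ - n / 2) k = scale (n / 2) k * scale (n / 2) k *
        scale ((n + 2 * σ) * (1 / 2)) k * scale (-n) k * scale (-n) k := by
      simp only [scale_mul]; congr 1; ring
    rw [e6, meanConst]
    ring
  have e7 : kernelMean D χ x w t - kernelMean D χ x w t' =
      (kernelMean D χ x w t - (∫ z, χ z) * m) - (kernelMean D χ x w t' - (∫ z, χ z) * m) := by ring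
  rw [e7]
  refine (enorm_sub_le).trans ((add_le_add (key t ht) (key t' ht')).trans_eq ?_)
  rw [← two_mul, hB, fracConst]
  ring

end Oscillation

/-! ### Existence of kernels, convergence of the means, pointwise estimates -/

section Pointwise

variable {n : ℕ} {D : Set (EuclideanSpace ℝ (Fin n))} {r M : ℝ} {x : EuclideanSpace ℝ (Fin n)}
  {χ : EuclideanSpace ℝ (Fin n) → ℝ}

/-- Under the cone condition there are cone kernels of mass `1` at all points of `D`, with uniform
constants. -/
theorem ConeCondition.exists_isConeKernel (hD : ConeCondition D) :
    ∃ r M : ℝ, 0 < r ∧ ∀ x ∈ D, ∃ ψ, IsConeKernel D r M x ψ ∧ ∫ z, ψ z = 1 := by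
  obtain ⟨R, c, hR, hc, hc1, h⟩ := hD
  -- A bump of radius ρ around the point at distance `R / 4` on the axis fits into the cone: `c (R/4
  -- + ρ) ≤ R/4 - ρ` because `2 ρ = (1 - c) R / 4`. Since `ρ ≤ R / 8`, its points have norm between
  -- `R / 8` and `3 R / 8`, and their multiples by factors below two remain within the height `R`.
  have hρ : 0 < R / 4 * ((1 - c) / 2) := by
    have : 0 < 1 - c := by linarith
    positivity
  set ρ := R / 4 * ((1 - c) / 2) with hρd
  let b : ContDiffBump (0 : EuclideanSpace ℝ (Fin n)) := ⟨ρ / 2, ρ, by positivity, by linarith⟩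
  obtain ⟨M, hM⟩ := (b.continuous_normed (μ := volume)).bounded_above_of_compact_support
    b.hasCompactSupport_normed
  refine ⟨R / 8, M, by positivity, fun x hx => ?_⟩
  obtain ⟨ξ, hξ, hcone⟩ := h x hx
  set p := (R / 4) • ξ with hp
  have hpn : ‖p‖ = R / 4 := by
    rw [hp, norm_smul, hξ, mul_one, Real.norm_of_nonneg (by positivity)]
  have hsupp : tsupport (fun z => b.normed volume (z - p)) ⊆ Metric.closedBall p ρ := by
    refine closure_minimal (fun z hz => ?_) Metric.isClosed_closedBall
    have : z - p ∈ Function.support (b.normed volume) := hz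
    rw [b.support_normed_eq, mem_ball_zero_iff] at this
    rw [mem_closedBall_iff_norm]
    exact this.le
  have hρ' : ρ ≤ R / 8 := by rw [hρd]; nlinarith
  refine ⟨fun z => b.normed volume (z - p), ⟨?_, ?_, ?_, ?_, ?_, ?_⟩, ?_⟩
  · exact b.contDiff_normed.comp (contDiff_id.sub contDiff_const)
  · exact HasCompactSupport.of_support_subset_isCompact (isCompact_closedBall p ρ)
      ((subset_tsupport _).trans hsupp)
  · exact fun z => hM (z - p)
  · intro z hz
    have h1 := mem_closedBall_iff_norm.1 (hsupp hz)
    have h2 := norm_sub_norm_le p z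
    rw [norm_sub_rev] at h2
    linarith
  · intro z hz
    have h1 := mem_closedBall_iff_norm.1 (hsupp hz)
    have h2 := norm_sub_norm_le z p
    linarith
  · intro z hz t ht ht2
    have h1 := mem_closedBall_iff_norm.1 (hsupp hz)
    have h2 := norm_sub_norm_le z p
    apply hcone
    · rw [norm_smul, Real.norm_of_nonneg ht.le]
      nlinarith [norm_nonneg z]
    · rw [norm_smul, Real.norm_of_nonneg ht.le, inner_smul_right]
      have h3 : inner ℝ ξ z = R / 4 + inner ℝ ξ (z - p) := by
        rw [inner_sub_right, hp, inner_smul_right, real_inner_self_eq_norm_sq, hξ]; ring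
      have h4 : -ρ ≤ inner ℝ ξ (z - p) := by
        have := abs_real_inner_le_norm ξ (z - p)
        rw [hξ, one_mul] at this
        linarith [neg_abs_le (inner ℝ ξ (z - p))]
      have h5 : c * ‖z‖ ≤ inner ℝ ξ z := by
        have h6 : c * ‖z‖ ≤ c * (R / 4 + ρ) := mul_le_mul_of_nonneg_left (by linarith) hc.le
        have h7 : c * ρ ≤ ρ := by nlinarith
        have h8 : c * (R / 4) = R / 4 - 2 * ρ := by rw [hρd]; ring
        linarith
      calc c * (t * ‖z‖) = t * (c * ‖z‖) := by ring
        _ ≤ _ := mul_le_mul_of_nonneg_left h5 ht.le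
  · rw [integral_sub_right_eq_self (fun z => b.normed volume z) p]
    exact b.integral_normed

/-- The means of an integrable function against cone kernels of mass `1` converge to the function
almost everywhere. -/
theorem ae_tendsto_kernelMean (hD : MeasurableSet D) (hr : 0 < r)
    {v : EuclideanSpace ℝ (Fin n) → ℝ} (hv : IntegrableOn v D) :
    ∀ᵐ x ∂volume.restrict D, ∀ ψ M, IsConeKernel D r M x ψ → ∫ z, ψ z = 1 →
      Filter.Tendsto (fun k : ℕ => kernelMean D ψ x v ((1 / 2) ^ k)) Filter.atTop (nhds (v x)) := by
  set f := D.indicator v with hf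
  have hfi : Integrable f := hv.integrable_indicator hD
  rw [ae_restrict_iff' hD]
  -- The exceptional null set comes from Lebesgue points of `v` extended by zero, so it is the same
  -- for all kernels at `x`.
  filter_upwards [IsUnifLocDoublingMeasure.ae_tendsto_average_norm_sub volume
    hfi.locallyIntegrable 1] with x hx hxD ψ M hψ hψ1
  have hδ : Filter.Tendsto (fun k : ℕ => 4 * r * (1 / 2 : ℝ) ^ k) Filter.atTop
      (nhdsWithin 0 (Set.Ioi 0)) := by
    refine tendsto_nhdsWithin_iff.2 ⟨?_, Filter.Eventually.of_forall fun k => ?_⟩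
    · simpa using (tendsto_pow_atTop_nhds_zero_of_lt_one (r := (1 / 2 : ℝ)) (by norm_num)
        (by norm_num)).const_mul (4 * r)
    · exact Set.mem_Ioi.2 (by positivity)
  have hlim := hx (fun _ => x) _ hδ (Filter.Eventually.of_forall fun k =>
    Metric.mem_closedBall_self (by positivity))
  have hlim2 := hlim.const_mul
    (M * volume.real (Metric.closedBall (0 : EuclideanSpace ℝ (Fin n)) (4 * r)))
  rw [mul_zero] at hlim2
  rw [tendsto_iff_norm_sub_tendsto_zero]
  refine squeeze_zero (fun _ => norm_nonneg _) (fun k => ?_) hlim2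
  set t : ℝ := (1 / 2) ^ k with ht
  have ht0 : 0 < t := by positivity
  have hψi : Integrable (dilate ψ x t) := (hψ.contDiff_dilate t).continuous.integrable_of_hasCompactSupport
    (hψ.hasCompactSupport_dilate ht0)
  have e1 : kernelMean D ψ x v t = ∫ y, f y * dilate ψ x t y := by
    rw [kernelMean_eq, ← integral_indicator hD]
    congr 1; ext y
    by_cases hy : y ∈ D <;> simp [hf, hy]
  have hfψ : Integrable (fun y => f y * dilate ψ x t y) :=
    hfi.mul_bdd hψi.aestronglyMeasurable (Filter.Eventually.of_forall (hψ.abs_dilate_le ht0))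
  have e2 : v x = ∫ y, f x * dilate ψ x t y := by
    rw [integral_const_mul, integral_dilate_univ ht0, hψ1, mul_one, hf, Set.indicator_of_mem hxD]
  have e3 : kernelMean D ψ x v t - v x =
      ∫ y in Metric.closedBall x (4 * r * t), (f y - f x) * dilate ψ x t y := by
    rw [e1, e2, ← integral_sub hfψ (hψi.const_mul _),
      setIntegral_eq_integral_of_forall_compl_eq_zero]
    · simp only [sub_mul]
    · intro y hy
      have : dilate ψ x t y = 0 := by
        by_contra h0
        apply hy
        have := (hψ.mem_shell hr.le (half_pow_mem_Icc k) h0).2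
        rwa [mem_closedBall_iff_norm]
      rw [this, mul_zero]
  have hvol : volume.real (Metric.closedBall x (4 * r * t)) =
      t ^ n * volume.real (Metric.closedBall (0 : EuclideanSpace ℝ (Fin n)) (4 * r)) := by
    rw [mul_comm (4 * r), Measure.real, Measure.addHaar_closedBall_mul volume x ht0.le (by positivity),
      finrank_euclideanSpace, Fintype.card_fin, ENNReal.toReal_mul, ENNReal.toReal_ofReal
      (by positivity)]
    rfl
  have hvol0 : 0 < volume.real (Metric.closedBall (0 : EuclideanSpace ℝ (Fin n)) (4 * r)) :=
    ENNReal.toReal_pos (Metric.measure_closedBall_pos volume _ (by positivity)).ne'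
      measure_closedBall_lt_top.ne
  have hint : IntegrableOn (fun y => ‖f y - f x‖) (Metric.closedBall x (4 * r * t)) :=
    (hfi.integrableOn.sub (integrableOn_const measure_closedBall_lt_top.ne)).norm
  rw [e3]
  calc ‖∫ y in Metric.closedBall x (4 * r * t), (f y - f x) * dilate ψ x t y‖
      ≤ ∫ y in Metric.closedBall x (4 * r * t), ‖f y - f x‖ * (t⁻¹ ^ n * M) := by
        refine norm_integral_le_of_norm_le (hint.mul_const _) (Filter.Eventually.of_forall fun y => ?_)
        rw [norm_mul]
        exact mul_le_mul_of_nonneg_left (hψ.abs_dilate_le ht0 y) (norm_nonneg _)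
    _ = _ := by
        rw [integral_mul_const, setAverage_eq, hvol, smul_eq_mul, inv_pow]
        field_simp

/-- Telescoping, with the limit taken at the end. -/
theorem enorm_le_of_tendsto {a : ℕ → ℝ} {l : ℝ} (h : Filter.Tendsto a Filter.atTop (nhds l)) :
    ‖l‖ₑ ≤ ‖a 0‖ₑ + ∑' k, ‖a (k + 1) - a k‖ₑ := by
  refine le_of_tendsto' (continuous_enorm.tendsto l |>.comp h) fun k => ?_
  have h1 : a k = a 0 + ∑ j ∈ Finset.range k, (a (j + 1) - a j) := by
    rw [Finset.sum_range_sub]; ring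
  calc ‖a k‖ₑ ≤ ‖a 0‖ₑ + ∑ j ∈ Finset.range k, ‖a (j + 1) - a j‖ₑ := by
        conv_lhs => rw [h1]
        exact (enorm_add_le _ _).trans (add_le_add le_rfl (enorm_sum_le _ _))
    _ ≤ _ := by gcongr; exact ENNReal.sum_le_tsum _

theorem OscBound.mono {C : ℝ≥0∞} {β : ℝ} {w : EuclideanSpace ℝ (Fin n) → ℝ} {q q' : ℕ → ℝ≥0∞}
    (h : OscBound D r x C β w q) (hq : ∀ k, q k ≤ q' k) : OscBound D r x C β w q' := by
  intro χ M hχ k t ht t' ht'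
  refine (h χ M hχ k t ht t' ht').trans ?_
  gcongr
  exact hq k

/-- Telescoping down to a finite scale only. It is meant for gradients, whose means may grow as the
scale shrinks. -/
theorem OscBound.enorm_kernelMean_half_pow_le {C : ℝ≥0∞} {β : ℝ} {w : EuclideanSpace ℝ (Fin n) → ℝ}
    {q : ℕ → ℝ≥0∞} (h : OscBound D r x C β w q) (hχ : IsConeKernel D r M x χ) (k : ℕ) :
    ‖kernelMean D χ x w ((1 / 2) ^ k)‖ₑ ≤ ‖kernelMean D χ x w 1‖ₑ +
      C * (ENNReal.ofReal M * ∑ j ∈ Finset.range k, scale β j * q j) := by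
  induction k with
  | zero => simp
  | succ k ih =>
    have h1 := h χ M hχ k _ (half_pow_succ_mem_Icc k) _ (half_pow_mem_Icc k)
    rw [Finset.sum_range_succ, mul_add, mul_add, ← add_assoc]
    calc ‖kernelMean D χ x w ((1 / 2) ^ (k + 1))‖ₑ
        = ‖kernelMean D χ x w ((1 / 2) ^ k) + (kernelMean D χ x w ((1 / 2) ^ (k + 1)) -
          kernelMean D χ x w ((1 / 2) ^ k))‖ₑ := by rw [add_sub_cancel]
      _ ≤ _ := (enorm_add_le _ _).trans (add_le_add ih h1)

theorem OscBound.enorm_kernelMean_le {C : ℝ≥0∞} {β : ℝ} {w : EuclideanSpace ℝ (Fin n) → ℝ}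
    {q : ℕ → ℝ≥0∞} (h : OscBound D r x C β w q) (hχ : IsConeKernel D r M x χ) {k : ℕ} {t : ℝ}
    (ht : t ∈ Set.Icc ((1 / 2 : ℝ) ^ (k + 1)) ((1 / 2) ^ k)) :
    ‖kernelMean D χ x w t‖ₑ ≤ ‖kernelMean D χ x w 1‖ₑ +
      C * (ENNReal.ofReal M * ∑ j ∈ Finset.range (k + 1), scale β j * q j) := by
  have h1 := h χ M hχ k t ht _ (half_pow_mem_Icc k)
  rw [Finset.sum_range_succ, mul_add, mul_add, ← add_assoc]
  calc ‖kernelMean D χ x w t‖ₑ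
      = ‖kernelMean D χ x w ((1 / 2) ^ k) + (kernelMean D χ x w t -
        kernelMean D χ x w ((1 / 2) ^ k))‖ₑ := by rw [add_sub_cancel]
    _ ≤ _ := (enorm_add_le _ _).trans (add_le_add (h.enorm_kernelMean_half_pow_le hχ k) h1)

/-- Pointwise estimate of a function with an oscillation bound. -/
theorem OscBound.enorm_le (hr : 0 < r) {C : ℝ≥0∞} {β : ℝ} {v : EuclideanSpace ℝ (Fin n) → ℝ}
    {q : ℕ → ℝ≥0∞} (h : OscBound D r x C β v q) (hv : AEMeasurable v (volume.restrict D))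
    (hχ : IsConeKernel D r M x χ)
    (hlim : Filter.Tendsto (fun k : ℕ => kernelMean D χ x v ((1 / 2) ^ k)) Filter.atTop
      (nhds (v x))) {A : ℝ≥0∞} (hA : (∫⁻ y in D, ‖v y‖ₑ ^ 2) ^ (1 / 2 : ℝ) ≤ A) :
    ‖v x‖ₑ ≤ ENNReal.ofReal M * (meanConst n r + C) * (A + ∑' k, scale β k * q k) := by
  have h1 : ‖kernelMean D χ x v ((1 / 2) ^ 0)‖ₑ ≤ ENNReal.ofReal M * (meanConst n r * A) := by
    rw [pow_zero]
    refine (enorm_kernelMean_one_le hχ hr.le hv).trans ?_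
    gcongr
  have h2 : ∑' k : ℕ, ‖kernelMean D χ x v ((1 / 2) ^ (k + 1)) - kernelMean D χ x v ((1 / 2) ^ k)‖ₑ ≤
      C * (ENNReal.ofReal M * ∑' k, scale β k * q k) := by
    rw [← ENNReal.tsum_mul_left, ← ENNReal.tsum_mul_left]
    exact ENNReal.tsum_le_tsum fun k =>
      h χ M hχ k _ (half_pow_succ_mem_Icc k) _ (half_pow_mem_Icc k)
  refine (enorm_le_of_tendsto hlim).trans ((add_le_add h1 h2).trans ?_)
  set S := ∑' k, scale β k * q k
  -- The added terms are the missing cross terms that complete the product.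
  calc _ ≤ ENNReal.ofReal M * (meanConst n r * A) + C * (ENNReal.ofReal M * S) +
        (ENNReal.ofReal M * (C * A) + ENNReal.ofReal M * (meanConst n r * S)) := le_self_add
    _ = _ := by ring

theorem tsum_scale_one : ∑' k, scale 1 k = 2 := by
  rw [tsum_scale]
  have : scale 1 1 = 2⁻¹ := by
    rw [← ofReal_half_pow, pow_one, one_div, ENNReal.ofReal_inv_of_pos two_pos, ENNReal.ofReal_ofNat]
  rw [this, ENNReal.one_sub_inv_two, inv_inv]

/-- Exchange of summation: the weights `2^{-k}` with `k ≥ j` add up to `2 · 2^{-j}`. This is how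
integrating the gradient's growth over the scales raises the exponent by one. -/
theorem tsum_scale_one_mul_sum (b : ℕ → ℝ≥0∞) :
    ∑' k, scale 1 k * ∑ j ∈ Finset.range (k + 1), b j = 2 * ∑' j, scale 1 j * b j := by
  have h1 : ∀ k, scale 1 k * ∑ j ∈ Finset.range (k + 1), b j =
      ∑' j, if j ≤ k then scale 1 k * b j else 0 := by
    intro k
    rw [Finset.mul_sum, tsum_eq_sum (s := Finset.range (k + 1))]
    · refine Finset.sum_congr rfl fun j hj => ?_
      rw [if_pos (Finset.mem_range_succ_iff.1 hj)]
    · intro j hj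
      rw [if_neg fun h => hj (Finset.mem_range_succ_iff.2 h)]
  simp only [h1]
  rw [ENNReal.tsum_comm, ← ENNReal.tsum_mul_left]
  refine tsum_congr fun j => ?_
  have h2 : ∀ k, (if j ≤ k + j then scale 1 (k + j) * b j else 0) = scale 1 k * (scale 1 j * b j) := by
    intro k
    rw [if_pos (Nat.le_add_left _ _), scale_add, mul_assoc]
  rw [← ENNReal.summable.sum_add_tsum_nat_add' (k := j), tsum_congr h2, ENNReal.tsum_mul_right,
    tsum_scale_one, Finset.sum_eq_zero, zero_add]
  intro k hk
  rw [if_neg (not_le.2 (Finset.mem_range.1 hk))]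

/-- The constant in the pointwise estimate by the oscillation of the gradient. -/
noncomputable def gradConst (n : ℕ) (r M : ℝ) (C : ℝ≥0∞) : ℝ≥0∞ :=
  ENNReal.ofReal M * (meanConst n r + 2 * n * ENNReal.ofReal (4 * r) * (meanConst n r + C))

theorem gradConst_ne_top (n : ℕ) (r M : ℝ) {C : ℝ≥0∞} (hC : C ≠ ⊤) : gradConst n r M C ≠ ⊤ := by
  unfold gradConst
  have := meanConst_ne_top n r
  finiteness

/-- Pointwise estimate of a function whose weak gradient has an oscillation bound. -/
theorem enorm_le_of_oscBound_gradient (hr : 0 < r) {C : ℝ≥0∞} {β : ℝ}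
    {v : EuclideanSpace ℝ (Fin n) → ℝ} {w : Fin n → EuclideanSpace ℝ (Fin n) → ℝ}
    (hv : IntegrableOn v D) (hw : ∀ i, HasWeakDeriv D (Pi.single i 1) v (w i))
    {q : ℕ → ℝ≥0∞} (h : ∀ i, OscBound D r x C β (w i) q)
    (hχ : IsConeKernel D r M x χ)
    (hlim : Filter.Tendsto (fun k : ℕ => kernelMean D χ x v ((1 / 2) ^ k)) Filter.atTop
      (nhds (v x))) {A : ℝ≥0∞} (hA : (∫⁻ y in D, ‖v y‖ₑ ^ 2) ^ (1 / 2 : ℝ) ≤ A)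
    (hA' : ∀ i, (∫⁻ y in D, ‖w i y‖ₑ ^ 2) ^ (1 / 2 : ℝ) ≤ A) :
    ‖v x‖ₑ ≤ gradConst n r M C * (A + ∑' k, scale (1 + β) k * q k) := by
  have h1 : ‖kernelMean D χ x v ((1 / 2) ^ 0)‖ₑ ≤ ENNReal.ofReal M * (meanConst n r * A) := by
    rw [pow_zero]
    refine (enorm_kernelMean_one_le hχ hr.le hv.aestronglyMeasurable.aemeasurable).trans ?_
    gcongr
  set m := ENNReal.ofReal (4 * r * M) with hm
  have hder : ∀ k, ∀ t ∈ Set.Icc ((1 / 2 : ℝ) ^ (k + 1)) ((1 / 2) ^ k),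
      ‖∑ i, kernelMean D (fun z => z i * χ z) x (w i) t‖ₑ ≤
        n * (m * (meanConst n r * A + C * ∑ j ∈ Finset.range (k + 1), scale β j * q j)) := by
    intro k t ht
    refine (enorm_sum_le _ _).trans ((Finset.sum_le_card_nsmul _ _
      (m * (meanConst n r * A + C * ∑ j ∈ Finset.range (k + 1), scale β j * q j))
        fun i _ => ?_).trans_eq (by simp [nsmul_eq_mul]))
    have h2 := (h i).enorm_kernelMean_le (hχ.coord_mul hr.le i) ht
    have h3 := enorm_kernelMean_one_le (hχ.coord_mul hr.le i) hr.le
      (hw i).2.1.aestronglyMeasurable.aemeasurable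
    calc _ ≤ m * (meanConst n r * A) +
          C * (m * ∑ j ∈ Finset.range (k + 1), scale β j * q j) := by
          refine h2.trans (add_le_add (h3.trans ?_) le_rfl)
          gcongr
          exact hA' i
      _ = _ := by ring
  have h4 : ∀ k : ℕ, ‖kernelMean D χ x v ((1 / 2) ^ (k + 1)) - kernelMean D χ x v ((1 / 2) ^ k)‖ₑ ≤
      n * m * (meanConst n r * A * scale 1 k +
        C * (scale 1 k * ∑ j ∈ Finset.range (k + 1), scale β j * q j)) := by
    intro k
    have h5 := enorm_sub_le_of_hasDerivAt (fun s hs => hχ.hasDerivAt_kernelMean hr.le hv hw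
      (pos_of_mem_Icc_half_pow hs) (lt_two_of_mem_Icc_half_pow hs)) (hder k)
      (half_pow_succ_mem_Icc k) (half_pow_mem_Icc k)
    refine h5.trans ((mul_le_mul_right (half_pow_sub_le k) _).trans_eq ?_)
    ring
  have h6 := ENNReal.tsum_le_tsum h4
  rw [ENNReal.tsum_mul_left, ENNReal.tsum_add, ENNReal.tsum_mul_left, ENNReal.tsum_mul_left,
    tsum_scale_one, tsum_scale_one_mul_sum] at h6
  simp only [← mul_assoc, scale_mul] at h6
  refine (enorm_le_of_tendsto hlim).trans ((add_le_add h1 h6).trans ?_)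
  rw [hm, ENNReal.ofReal_mul (by positivity), gradConst]
  set S := ∑' k, scale (1 + β) k * q k
  set a := ENNReal.ofReal M
  set b := ENNReal.ofReal (4 * r)
  set K := meanConst n r
  calc _ ≤ a * (K * A) + n * (b * a) * (K * A * 2 + C * 2 * S) +
      (a * K * S + a * 2 * n * b * (C * A + K * S)) := le_self_add
    _ = _ := by ring

end Pointwise

/-! ### Pointwise bounds for Sobolev functions -/

section Sobolev

variable {n : ℕ} {D : Set (EuclideanSpace ℝ (Fin n))} {s : ℝ}
  {v : EuclideanSpace ℝ (Fin n) → ℝ} {α : Fin n → ℕ}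

theorem sobolevNorm_sq (D : Set (EuclideanSpace ℝ (Fin n))) (s : ℝ)
    (v : EuclideanSpace ℝ (Fin n) → ℝ) :
    sobolevNorm D s v ^ 2 =
      (∑ k ∈ Finset.range (⌊s⌋₊ + 1), ∑ α ∈ Finset.piAntidiag (Finset.univ : Finset (Fin n)) k,
        eLpNorm (weakDeriv D α v) 2 (volume.restrict D) ^ 2) +
      (if Int.fract s = 0 then 0 else
        ∑ α ∈ Finset.piAntidiag (Finset.univ : Finset (Fin n)) ⌊s⌋₊,
          gagliardoSq D (Int.fract s) (weakDeriv D α v)) :=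
  rpow_half_sq _

theorem lintegral_enorm_sq_eq {μ : Measure (EuclideanSpace ℝ (Fin n))}
    (f : EuclideanSpace ℝ (Fin n) → ℝ) : ∫⁻ y, ‖f y‖ₑ ^ 2 ∂μ = eLpNorm f 2 μ ^ 2 := by
  have := eLpNorm_nnreal_pow_eq_lintegral (f := f) (μ := μ) (p := 2) two_ne_zero
  simpa using this.symm

theorem eLpNorm_weakDeriv_sq_le (hα : ∑ i, α i ≤ ⌊s⌋₊) :
    eLpNorm (weakDeriv D α v) 2 (volume.restrict D) ^ 2 ≤ sobolevNorm D s v ^ 2 := by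
  rw [sobolevNorm_sq]
  refine le_add_right ?_
  refine le_trans ?_ (Finset.single_le_sum (f := fun k =>
    ∑ α ∈ Finset.piAntidiag (Finset.univ : Finset (Fin n)) k,
      eLpNorm (weakDeriv D α v) 2 (volume.restrict D) ^ 2) (fun _ _ => zero_le)
      (Finset.mem_range_succ_iff.2 hα))
  exact Finset.single_le_sum (f := fun α => eLpNorm (weakDeriv D α v) 2 (volume.restrict D) ^ 2)
    (fun _ _ => zero_le) (by simp)

theorem gagliardoSq_weakDeriv_le (hα : ∑ i, α i = ⌊s⌋₊) (hs : Int.fract s ≠ 0) :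
    gagliardoSq D (Int.fract s) (weakDeriv D α v) ≤ sobolevNorm D s v ^ 2 := by
  rw [sobolevNorm_sq, if_neg hs]
  refine le_add_left ?_
  exact Finset.single_le_sum (f := fun α => gagliardoSq D (Int.fract s) (weakDeriv D α v))
    (fun _ _ => zero_le) (by simp [hα])

/-- A weak derivative has a measurable representative, with the bounds that come with the Sobolev
norm. -/
theorem MemSobolev.exists_measurable_weakDeriv (hDo : IsOpen D) (h : MemSobolev D s v)
    (hα : ∑ i, α i ≤ ⌊s⌋₊) :
    ∃ w, Measurable w ∧ HasWeakDeriv D α v w ∧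
      ∫⁻ y in D, ‖w y‖ₑ ^ 2 ≤ sobolevNorm D s v ^ 2 ∧
      (∑ i, α i = ⌊s⌋₊ → Int.fract s ≠ 0 →
        ∫⁻ y in D, gagliardoDensity D (Int.fract s) w y ≤ sobolevNorm D s v ^ 2) := by
  have hw := HasWeakDeriv.weakDeriv (h.1 α hα)
  have hm := hw.2.1.aestronglyMeasurable.aemeasurable
  have hae := hm.ae_eq_mk
  refine ⟨hm.mk _, hm.measurable_mk, hw.congr_ae hDo (ae_eq_refl _) hae, ?_, fun hα' hs => ?_⟩
  · rw [lintegral_enorm_sq_eq, ← eLpNorm_congr_ae hae]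
    exact eLpNorm_weakDeriv_sq_le hα
  · refine le_trans (le_of_eq ?_) (gagliardoSq_weakDeriv_le (D := D) (v := v) hα' hs)
    unfold gagliardoSq gagliardoDensity
    refine lintegral_congr_ae ?_
    filter_upwards [hae] with y hy
    refine lintegral_congr_ae ?_
    filter_upwards [hae] with z hz
    rw [hy, hz]

theorem integrableOn_of_lintegral_sq (hDb : Bornology.IsBounded D)
    {w : EuclideanSpace ℝ (Fin n) → ℝ} (hw : Measurable w) {B : ℝ≥0∞} (hB : B ≠ ⊤)
    (h : ∫⁻ y in D, ‖w y‖ₑ ^ 2 ≤ B) : IntegrableOn w D := by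
  have : IsFiniteMeasure (volume.restrict D) := ⟨by
    rw [Measure.restrict_apply_univ]; exact hDb.measure_lt_top⟩
  have hL : MemLp w 2 (volume.restrict D) := by
    refine ⟨hw.aestronglyMeasurable, ?_⟩
    rw [lintegral_enorm_sq_eq] at h
    by_contra hc
    rw [not_lt, top_le_iff] at hc
    rw [hc] at h
    exact hB (top_le_iff.1 (by simpa using h))
  exact hL.integrable (by norm_num)

theorem measurable_gagliardoDensity (D : Set (EuclideanSpace ℝ (Fin n))) (σ : ℝ)
    {w : EuclideanSpace ℝ (Fin n) → ℝ} (hw : Measurable w) :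
    Measurable (gagliardoDensity D σ w) := by
  have h : Measurable fun p : EuclideanSpace ℝ (Fin n) × EuclideanSpace ℝ (Fin n) =>
      ENNReal.ofReal (|w p.1 - w p.2| ^ 2 / ‖p.1 - p.2‖ ^ ((n : ℝ) + 2 * σ)) := by fun_prop
  exact h.lintegral_prod_right'

/-- `v` is bounded pointwise by dyadic sums of local `L²` norms of a density. -/
def PointwiseBound (D : Set (EuclideanSpace ℝ (Fin n))) (r : ℝ) (C : ℝ≥0∞) (β : ℝ) (N : ℝ≥0∞)
    (v : EuclideanSpace ℝ (Fin n) → ℝ) : Prop :=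
  ∃ Γ : EuclideanSpace ℝ (Fin n) → ℝ≥0∞, Measurable Γ ∧ ∫⁻ y in D, Γ y ≤ C * N ^ 2 ∧
    ∀ᵐ x ∂volume.restrict D,
      ‖v x‖ₑ ≤ C * (N + ∑' k, scale β k * (∫⁻ y in D ∩ shell r x k, Γ y) ^ (1 / 2 : ℝ))

theorem rpow_half_le_of_le_sq {a b : ℝ≥0∞} (h : a ≤ b ^ 2) : a ^ (1 / 2 : ℝ) ≤ b :=
  (ENNReal.rpow_le_rpow h (by norm_num)).trans_eq (sq_rpow_half b)

/-- Functions in a Sobolev space satisfy pointwise bounds by dyadic sums. -/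
theorem exists_pointwiseBound (hDo : IsOpen D) (hDb : Bornology.IsBounded D)
    (hDc : ConeCondition D) (hs : 0 < s) :
    ∃ r : ℝ, ∃ C : ℝ≥0∞, 0 < r ∧ C ≠ ⊤ ∧ ∀ v : EuclideanSpace ℝ (Fin n) → ℝ,
      MemSobolev D s v → PointwiseBound D r C (min s 2 - n / 2) (sobolevNorm D s v) v := by
  obtain ⟨r, M, hr, hcone⟩ := hDc.exists_isConeKernel
  have hDm := hDo.measurableSet
  have hfl : (⌊s⌋₊ : ℝ) + Int.fract s = s := by
    rw [natCast_floor_eq_intCast_floor hs.le]; exact Int.floor_add_fract s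
  have h0 : ∑ i : Fin n, (0 : Fin n → ℕ) i ≤ ⌊s⌋₊ := by simp
  have hsingle : ∀ i : Fin n, ∑ j, (Pi.single i 1 : Fin n → ℕ) j = 1 := by simp
  have hdouble : ∀ i j : Fin n, ∑ k, (Pi.single i 1 + Pi.single j 1 : Fin n → ℕ) k = 2 := by
    simp [Finset.sum_add_distrib]
  refine ⟨r, ?_⟩
  rcases Nat.lt_or_ge ⌊s⌋₊ 1 with hm0 | hm1
  · -- fractional smoothness of `v`
    have hm : ⌊s⌋₊ = 0 := by omega
    have hσ : Int.fract s = s := by rw [hm] at hfl; simpa using hfl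
    have hs1 : s < 1 := by rw [← hσ]; exact Int.fract_lt_one s
    -- One constant serves both parts of `PointwiseBound`; the summand 1 covers the integral of the
    -- density. In the other cases `n` and `n * n` count the components of the gradient and of the
    -- Hessian.
    refine ⟨ENNReal.ofReal M * (meanConst n r + fracConst n r s M) + 1, hr, ?_, fun v hv => ?_⟩
    · have := meanConst_ne_top n r
      have := fracConst_ne_top n r s M
      finiteness
    obtain ⟨v₀, hv₀m, hv₀, hv₀2, hv₀g⟩ := hv.exists_measurable_weakDeriv hDo h0
    rw [hσ] at hv₀g
    have hvi := integrableOn_of_lintegral_sq hDb hv₀m (by have := hv.2.ne; finiteness) hv₀2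
    refine ⟨gagliardoDensity D s v₀, measurable_gagliardoDensity D s hv₀m,
      (hv₀g (by simp [hm]) hs.ne').trans ?_, ?_⟩
    · exact le_mul_of_one_le_left zero_le le_add_self
    filter_upwards [hv₀.ae_eq_of_zero hDo, ae_tendsto_kernelMean hDm hr hvi,
      ae_restrict_mem hDm] with x hx hlim hxD
    obtain ⟨ψ, hψ, hψ1⟩ := hcone x hxD
    have hosc := oscBound_of_gagliardo hDm hr hs.le hvi hv₀m hψ hψ1
    rw [hx, min_eq_left (by linarith)]
    refine (hosc.enorm_le hr hv₀m.aemeasurable hψ (hlim ψ M hψ hψ1)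
      (rpow_half_le_of_le_sq hv₀2)).trans ?_
    exact mul_le_mul_left le_self_add _
  · have h1 : ∀ i : Fin n, ∑ j, (Pi.single i 1 : Fin n → ℕ) j ≤ ⌊s⌋₊ := fun i =>
      (hsingle i).trans_le hm1
    rcases Nat.lt_or_ge ⌊s⌋₊ 2 with hm2 | hm2
    · have hm : ⌊s⌋₊ = 1 := by omega
      by_cases hf : Int.fract s = 0
      · -- one derivative
        have hs1 : s = 1 := by rw [hm, hf] at hfl; simpa using hfl.symm
        refine ⟨ENNReal.ofReal M * (meanConst n r +
          n * (ENNReal.ofReal (4 * r) * meanConst n r)) + n, hr, ?_, fun v hv => ?_⟩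
        · have := meanConst_ne_top n r
          finiteness
        obtain ⟨v₀, hv₀m, hv₀, hv₀2, -⟩ := hv.exists_measurable_weakDeriv hDo h0
        choose w hwm hw hw2 hwg using fun i => hv.exists_measurable_weakDeriv hDo (h1 i)
        have hvi := integrableOn_of_lintegral_sq hDb hv₀m (by have := hv.2.ne; finiteness) hv₀2
        have hae := hv₀.ae_eq_of_zero hDo
        refine ⟨fun y => ∑ i, ‖w i y‖ₑ ^ 2, by fun_prop, ?_, ?_⟩
        · rw [lintegral_finsetSum _ fun i _ => (hwm i).enorm.pow_const 2]
          refine (Finset.sum_le_card_nsmul _ _ _ fun i _ => hw2 i).trans ?_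
          rw [nsmul_eq_mul, Finset.card_univ, Fintype.card_fin]
          gcongr
          exact le_add_self
        filter_upwards [hae, ae_tendsto_kernelMean hDm hr hvi,
          ae_restrict_mem hDm] with x hx hlim hxD
        obtain ⟨ψ, hψ, hψ1⟩ := hcone x hxD
        have hosc := oscBound_of_gradient (x := x) hr.le hvi
          (fun i => (hw i).congr_ae hDo hae (ae_eq_refl _))
          (Γ := fun y => ∑ i, ‖w i y‖ₑ ^ 2) (fun i y => Finset.single_le_sum
            (f := fun i => ‖w i y‖ₑ ^ 2) (fun _ _ => zero_le) (Finset.mem_univ i))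
        rw [hx, hs1, min_eq_left one_le_two]
        rw [hs1] at hv₀2
        refine (hosc.enorm_le hr hv₀m.aemeasurable hψ (hlim ψ M hψ hψ1)
          (rpow_half_le_of_le_sq hv₀2)).trans ?_
        exact mul_le_mul_left le_self_add _
      · -- one derivative of fractional smoothness
        set σ := Int.fract s with hσ
        have hs1 : s = 1 + σ := by rw [hm] at hfl; simpa using hfl.symm
        have hσ1 : σ < 1 := Int.fract_lt_one s
        refine ⟨gradConst n r M (fracConst n r σ M) + n, hr, ?_, fun v hv => ?_⟩
        · have := gradConst_ne_top n r M (fracConst_ne_top n r σ M)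
          finiteness
        obtain ⟨v₀, hv₀m, hv₀, hv₀2, -⟩ := hv.exists_measurable_weakDeriv hDo h0
        choose w hwm hw hw2 hwg using fun i => hv.exists_measurable_weakDeriv hDo (h1 i)
        have hvi := integrableOn_of_lintegral_sq hDb hv₀m (by have := hv.2.ne; finiteness) hv₀2
        have hwi := fun i => integrableOn_of_lintegral_sq hDb (hwm i)
          (by have := hv.2.ne; finiteness) (hw2 i)
        have hae := hv₀.ae_eq_of_zero hDo
        refine ⟨fun y => ∑ i, gagliardoDensity D σ (w i) y,
          Finset.measurable_sum _ fun i _ => measurable_gagliardoDensity D σ (hwm i), ?_, ?_⟩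
        · rw [lintegral_finsetSum _ fun i _ => measurable_gagliardoDensity D σ (hwm i)]
          refine (Finset.sum_le_card_nsmul _ _ _ fun i _ =>
            hwg i ((hsingle i).trans hm.symm) hf).trans ?_
          rw [nsmul_eq_mul, Finset.card_univ, Fintype.card_fin]
          gcongr
          exact le_add_self
        filter_upwards [hae, ae_tendsto_kernelMean hDm hr hvi,
          ae_restrict_mem hDm] with x hx hlim hxD
        obtain ⟨ψ, hψ, hψ1⟩ := hcone x hxD
        have hosc := fun i => (oscBound_of_gagliardo hDm hr (Int.fract_nonneg s) (hwi i) (hwm i)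
          hψ hψ1).mono (q' := fun k => (∫⁻ y in D ∩ shell r x k,
            ∑ i, gagliardoDensity D σ (w i) y) ^ (1 / 2 : ℝ)) fun k =>
            ENNReal.rpow_le_rpow (lintegral_mono fun y => Finset.single_le_sum
              (f := fun i => gagliardoDensity D σ (w i) y) (fun _ _ => zero_le)
              (Finset.mem_univ i)) (by norm_num)
        have hb := enorm_le_of_oscBound_gradient hr hvi
          (fun i => (hw i).congr_ae hDo hae (ae_eq_refl _)) hosc hψ (hlim ψ M hψ hψ1)
          (rpow_half_le_of_le_sq hv₀2) (fun i => rpow_half_le_of_le_sq (hw2 i))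
        have hβ : min s 2 - n / 2 = 1 + (σ - n / 2) := by
          rw [min_eq_left (by linarith)]; linarith
        rw [hx, hβ]
        refine hb.trans ?_
        exact mul_le_mul_left le_self_add _
    · -- two derivatives
      have hs2 : 2 ≤ s := (Nat.cast_le.2 hm2).trans (Nat.floor_le hs.le)
      refine ⟨gradConst n r M (n * (ENNReal.ofReal (4 * r) * meanConst n r)) + n * n, hr, ?_,
        fun v hv => ?_⟩
      · have h3 := meanConst_ne_top n r
        have := gradConst_ne_top n r M (C := n * (ENNReal.ofReal (4 * r) * meanConst n r))
          (by finiteness)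
        finiteness
      obtain ⟨v₀, hv₀m, hv₀, hv₀2, -⟩ := hv.exists_measurable_weakDeriv hDo h0
      choose w hwm hw hw2 hwg using fun i => hv.exists_measurable_weakDeriv hDo (h1 i)
      choose u hum hu hu2 hug using fun i j => hv.exists_measurable_weakDeriv hDo
        ((hdouble i j).trans_le hm2)
      have hvi := integrableOn_of_lintegral_sq hDb hv₀m (by have := hv.2.ne; finiteness) hv₀2
      have hwi := fun i => integrableOn_of_lintegral_sq hDb (hwm i)
        (by have := hv.2.ne; finiteness) (hw2 i)
      have hae := hv₀.ae_eq_of_zero hDo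
      have hum2 : ∀ i, Measurable fun y => ∑ j, ‖u i j y‖ₑ ^ 2 := fun i =>
        Finset.measurable_sum _ fun j _ => (hum i j).enorm.pow_const 2
      refine ⟨fun y => ∑ i, ∑ j, ‖u i j y‖ₑ ^ 2, Finset.measurable_sum _ fun i _ => hum2 i, ?_, ?_⟩
      · rw [lintegral_finsetSum _ fun i _ => hum2 i]
        have h4 : ∀ i, ∫⁻ y in D, ∑ j, ‖u i j y‖ₑ ^ 2 ≤ n * sobolevNorm D s v ^ 2 := by
          intro i
          rw [lintegral_finsetSum _ fun j _ => (hum i j).enorm.pow_const 2]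
          refine (Finset.sum_le_card_nsmul _ _ _ fun j _ => hu2 i j).trans ?_
          rw [nsmul_eq_mul, Finset.card_univ, Fintype.card_fin]
        refine (Finset.sum_le_card_nsmul _ _ _ fun i _ => h4 i).trans ?_
        rw [nsmul_eq_mul, Finset.card_univ, Fintype.card_fin, ← mul_assoc]
        gcongr
        exact le_add_self
      filter_upwards [hae, ae_tendsto_kernelMean hDm hr hvi,
        ae_restrict_mem hDm] with x hx hlim hxD
      obtain ⟨ψ, hψ, hψ1⟩ := hcone x hxD
      -- The Sobolev norm controls weak derivatives of `v` itself; `of_add_single` makes the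
      -- second-order ones weak gradients of the first-order ones.
      have hosc := fun i => oscBound_of_gradient (x := x) hr.le (hwi i)
        (fun j => (hw i).of_add_single j (hu i j))
        (Γ := fun y => ∑ i, ∑ j, ‖u i j y‖ₑ ^ 2) (fun j y => (Finset.single_le_sum
          (f := fun j => ‖u i j y‖ₑ ^ 2) (fun _ _ => zero_le) (Finset.mem_univ j)).trans
          (Finset.single_le_sum (f := fun i => ∑ j, ‖u i j y‖ₑ ^ 2) (fun _ _ => zero_le)
            (Finset.mem_univ i)))
      have hb := enorm_le_of_oscBound_gradient hr hvi
        (fun i => (hw i).congr_ae hDo hae (ae_eq_refl _)) hosc hψ (hlim ψ M hψ hψ1)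
        (rpow_half_le_of_le_sq hv₀2) (fun i => rpow_half_le_of_le_sq (hw2 i))
      have hβ : min s 2 - n / 2 = 1 + (1 - (n : ℝ) / 2) := by
        rw [min_eq_right hs2]; ring
      rw [hx, hβ]
      refine hb.trans ?_
      exact mul_le_mul_left le_self_add _

end Sobolev

/-! ### Splitting the dyadic sum: pointwise head and L² tail -/

section Summation

variable {n : ℕ} {D : Set (EuclideanSpace ℝ (Fin n))} {r : ℝ}
  {Γ : EuclideanSpace ℝ (Fin n) → ℝ≥0∞}

/-- The outer and inner radii of a shell have ratio 8, so a common point forces `2^{l-k} ≤ 8`. -/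
theorem lt_add_four_of_mem_shell (hr : 0 < r) {x y : EuclideanSpace ℝ (Fin n)} {k l : ℕ}
    (hk : y ∈ shell r x k) (hl : y ∈ shell r x l) : l < k + 4 := by
  by_contra! h
  have h1 : ((1 : ℝ) / 2) ^ l ≤ (1 / 2) ^ (k + 4) :=
    pow_le_pow_of_le_one (by norm_num) (by norm_num) h
  have h2 := hk.1.trans hl.2
  have h3 : r / 2 * (1 / 2) ^ k ≤ 4 * r * (1 / 2) ^ (k + 4) :=
    h2.trans (mul_le_mul_of_nonneg_left h1 (by positivity))
  have h4 : 0 < r * (1 / 2 : ℝ) ^ k := by positivity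
  have h5 : 4 * r * (1 / 2 : ℝ) ^ (k + 4) = r * (1 / 2) ^ k / 4 := by ring
  rw [h5] at h3
  linarith

theorem tsum_indicator_shell_le (hr : 0 < r) (x y : EuclideanSpace ℝ (Fin n)) (a : ℝ≥0∞) :
    ∑' k, (shell r x k).indicator (fun _ => a) y ≤ 4 * a := by
  classical
  by_cases h : ∃ k, y ∈ shell r x k
  · rw [tsum_eq_sum (s := Finset.Ico (Nat.find h) (Nat.find h + 4))]
    · refine (Finset.sum_le_card_nsmul _ _ a fun k _ => Set.indicator_le_self _ _ _).trans ?_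
      simp
    · intro k hk
      refine Set.indicator_of_notMem (fun hy => hk (Finset.mem_Ico.2 ⟨Nat.find_min' h hy, ?_⟩)) _
      exact lt_add_four_of_mem_shell hr (Nat.find_spec h) hy
  · rw [ENNReal.tsum_eq_zero.2 fun k => Set.indicator_of_notMem (fun hy => h ⟨k, hy⟩) _]
    exact zero_le

theorem setLIntegral_inter_shell (D : Set (EuclideanSpace ℝ (Fin n))) (r : ℝ)
    (x : EuclideanSpace ℝ (Fin n)) (k : ℕ) (Γ : EuclideanSpace ℝ (Fin n) → ℝ≥0∞) :
    ∫⁻ y in D ∩ shell r x k, Γ y = ∫⁻ y in D, (shell r x k).indicator (fun _ => Γ y) y := by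
  rw [Set.inter_comm, ← Measure.restrict_restrict (measurableSet_shell r x k),
    ← lintegral_indicator (measurableSet_shell r x k)]
  rfl

theorem measurable_indicator_shell (r : ℝ) (k : ℕ) (hΓ : Measurable Γ) :
    Measurable fun p : EuclideanSpace ℝ (Fin n) × EuclideanSpace ℝ (Fin n) =>
      (shell r p.1 k).indicator (fun _ => Γ p.2) p.2 := by
  have h : Measurable fun p : EuclideanSpace ℝ (Fin n) × EuclideanSpace ℝ (Fin n) =>
      ‖p.2 - p.1‖ := by fun_prop
  have hs : MeasurableSet {p : EuclideanSpace ℝ (Fin n) × EuclideanSpace ℝ (Fin n) |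
      p.2 ∈ shell r p.1 k} :=
    (measurableSet_le measurable_const h).inter (measurableSet_le h measurable_const)
  exact (hΓ.comp measurable_snd).indicator hs

theorem measurable_setLIntegral_shell (D : Set (EuclideanSpace ℝ (Fin n))) (r : ℝ) (k : ℕ)
    (hΓ : Measurable Γ) : Measurable fun x => ∫⁻ y in D ∩ shell r x k, Γ y := by
  simp only [setLIntegral_inter_shell]
  exact (measurable_indicator_shell r k hΓ).lintegral_prod_right'

theorem tsum_setLIntegral_shell_le (hr : 0 < r) (hΓ : Measurable Γ)
    (x : EuclideanSpace ℝ (Fin n)) :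
    ∑' k, ∫⁻ y in D ∩ shell r x k, Γ y ≤ 4 * ∫⁻ y in D, Γ y := by
  simp only [setLIntegral_inter_shell]
  have hm : ∀ k, Measurable fun y => (shell r x k).indicator (fun _ => Γ y) y := fun k =>
    hΓ.indicator (measurableSet_shell r x k)
  rw [← lintegral_tsum fun k => (hm k).aemeasurable, ← lintegral_const_mul' _ _ (by simp)]
  exact lintegral_mono fun y => tsum_indicator_shell_le hr x y (Γ y)

theorem mem_shell_comm {x y : EuclideanSpace ℝ (Fin n)} {k : ℕ} :
    y ∈ shell r x k ↔ x ∈ shell r y k := by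
  simp only [shell, Set.mem_ofPred_eq, norm_sub_rev]

/-- Tonelli and the symmetry of the shell relation in `x` and `y`: each `y` is counted with at most
the volume of its own shell. -/
theorem lintegral_setLIntegral_shell_le (hr : 0 ≤ r) (hΓ : Measurable Γ) (k : ℕ) :
    ∫⁻ x in D, ∫⁻ y in D ∩ shell r x k, Γ y ≤
      scale n k * ballConst n r ^ 2 * ∫⁻ y in D, Γ y := by
  simp only [setLIntegral_inter_shell]
  rw [lintegral_lintegral_swap (measurable_indicator_shell r k hΓ).aemeasurable,
    ← lintegral_const_mul _ hΓ]
  refine lintegral_mono fun y => ?_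
  have h1 : ∀ x, (shell r x k).indicator (fun _ => Γ y) y =
      (shell r y k).indicator (fun _ => Γ y) x := by
    intro x
    by_cases h : y ∈ shell r x k
    · rw [Set.indicator_of_mem h, Set.indicator_of_mem (mem_shell_comm.1 h)]
    · rw [Set.indicator_of_notMem h, Set.indicator_of_notMem fun h' => h (mem_shell_comm.2 h')]
  simp only [h1]
  rw [lintegral_indicator_const (measurableSet_shell r y k), mul_comm (Γ y), ballConst,
    rpow_half_sq]
  gcongr
  exact (Measure.restrict_apply_le _ _).trans (volume_shell_le hr y k)

/-- Cauchy–Schwarz for counting measure, with each weight split into two square roots. -/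
theorem sq_tsum_mul_le (a b : ℕ → ℝ≥0∞) :
    (∑' k, a k * b k) ^ 2 ≤ (∑' k, a k) * ∑' k, a k * b k ^ 2 := by
  have h := ENNReal.lintegral_mul_le_Lp_mul_Lq Measure.count Real.HolderConjugate.two_two
    (f := fun k => a k ^ (1 / 2 : ℝ)) (g := fun k => a k ^ (1 / 2 : ℝ) * b k)
    (measurable_of_countable _).aemeasurable (measurable_of_countable _).aemeasurable
  simp only [lintegral_count, Pi.mul_apply, ← mul_assoc, ← sq, ENNReal.rpow_ofNat, mul_pow,
    rpow_half_sq] at h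
  calc _ ≤ ((∑' k, a k) ^ (1 / 2 : ℝ) * (∑' k, a k * b k ^ 2) ^ (1 / 2 : ℝ)) ^ 2 := by gcongr
    _ = _ := by rw [mul_pow, rpow_half_sq, rpow_half_sq]

theorem le_of_sq_le_sq {a b : ℝ≥0∞} (h : a ^ 2 ≤ b ^ 2) : a ≤ b :=
  (sq_rpow_half a).symm.trans_le (rpow_half_le_of_le_sq h)

theorem add_sq_le_two_mul_sq (a b : ℝ≥0∞) : (a + b) ^ 2 ≤ 2 * a ^ 2 + 2 * b ^ 2 := by
  wlog h : a ≤ b generalizing a b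
  · rw [add_comm a, add_comm (2 * a ^ 2)]
    exact this b a (le_of_not_ge h)
  obtain ⟨c, rfl⟩ := exists_add_of_le h
  calc (a + (a + c)) ^ 2 ≤ (a + (a + c)) ^ 2 + c ^ 2 := le_self_add
    _ = _ := by ring

theorem tsum_scale_add (a : ℝ) (K : ℕ) : ∑' k, scale a (k + K) = scale a K * ∑' k, scale a k := by
  rw [← ENNReal.tsum_mul_left]
  exact tsum_congr fun k => by rw [scale_add, mul_comm]

/-- The tail of the dyadic sum is small in `L²`. -/
theorem lintegral_sq_tail_le (hr : 0 ≤ r) (hΓ : Measurable Γ) {s : ℝ} (K : ℕ) :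
    ∫⁻ x in D, (∑' k, scale (s - n / 2) (k + K) *
      (∫⁻ y in D ∩ shell r x (k + K), Γ y) ^ (1 / 2 : ℝ)) ^ 2 ≤
      (scale s K * (∑' k, scale s k) * ballConst n r) ^ 2 * ∫⁻ y in D, Γ y := by
  have h1 : ∀ x : EuclideanSpace ℝ (Fin n), (∑' k, scale (s - n / 2) (k + K) *
      (∫⁻ y in D ∩ shell r x (k + K), Γ y) ^ (1 / 2 : ℝ)) ^ 2 ≤
      (scale s K * ∑' k, scale s k) *
        ∑' k, scale (s - n) (k + K) * ∫⁻ y in D ∩ shell r x (k + K), Γ y := by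
    intro x
    -- With the weight `2^{-sk}` the square of the remaining factor carries `2^{nk}`, which the
    -- shell volume absorbs after integration in `x`. Both factors are then tails of one geometric
    -- series.
    have h2 := sq_tsum_mul_le (fun k => scale s (k + K)) (fun k => scale (-(n / 2)) (k + K) *
      (∫⁻ y in D ∩ shell r x (k + K), Γ y) ^ (1 / 2 : ℝ))
    simp only [mul_pow, rpow_half_sq, ← mul_assoc, sq (scale _ _), scale_mul] at h2
    rw [tsum_scale_add] at h2
    refine Eq.trans_le ?_ (h2.trans_eq ?_)
    · rw [sub_eq_add_neg]
    · congr 1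
      refine tsum_congr fun k => ?_
      congr 2; ring
  have hSK : scale s K * ∑' k, scale s k = ∑' k, scale s (k + K) := (tsum_scale_add s K).symm
  calc _ ≤ ∫⁻ x in D, (scale s K * ∑' k, scale s k) *
        ∑' k, scale (s - n) (k + K) * ∫⁻ y in D ∩ shell r x (k + K), Γ y :=
        lintegral_mono h1
    _ = (scale s K * ∑' k, scale s k) * ∑' k, scale (s - n) (k + K) *
        ∫⁻ x in D, ∫⁻ y in D ∩ shell r x (k + K), Γ y := by
        have hm := fun k => measurable_setLIntegral_shell D r (k + K) hΓ
        rw [lintegral_const_mul _ (Measurable.tsum fun k => (hm k).const_mul _),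
          lintegral_tsum fun k => ((hm k).const_mul _).aemeasurable]
        congr 1
        exact tsum_congr fun k => lintegral_const_mul _ (hm k)
    _ ≤ (scale s K * ∑' k, scale s k) * ∑' k, scale s (k + K) *
        (ballConst n r ^ 2 * ∫⁻ y in D, Γ y) := by
        refine mul_le_mul_right (ENNReal.tsum_le_tsum fun k => ?_) _
        refine (mul_le_mul_right (lintegral_setLIntegral_shell_le hr hΓ (k + K)) _).trans_eq ?_
        rw [← mul_assoc, ← mul_assoc, scale_mul, sub_add_cancel, mul_assoc]
    _ = _ := by
        rw [ENNReal.tsum_mul_right, ← hSK]; ring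

/-- The constant in the estimate on small sets. -/
noncomputable def smallConst (n : ℕ) (r : ℝ) (C : ℝ≥0∞) (s : ℝ) : ℝ≥0∞ :=
  2 * C * (1 + (∑' k, scale s k) * ballConst n r * C ^ (1 / 2 : ℝ))

theorem smallConst_ne_top (n : ℕ) (r : ℝ) {C : ℝ≥0∞} (hC : C ≠ ⊤) {s : ℝ} (hs : 0 < s) :
    smallConst n r C s ≠ ⊤ := by
  unfold smallConst
  have h1 := tsum_scale_ne_top hs
  have h2 := ballConst_ne_top n r
  have h3 : C ^ (1 / 2 : ℝ) ≠ ⊤ := ENNReal.rpow_ne_top_of_nonneg (by norm_num) hC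
  finiteness

/-- A pointwise bound gives estimates in `L²` of small sets, by splitting the dyadic sum. -/
theorem PointwiseBound.eLpNorm_le (hr : 0 < r) {C N P : ℝ≥0∞} {s : ℝ}
    {v : EuclideanSpace ℝ (Fin n) → ℝ} (h : PointwiseBound D r C (s - n / 2) N v) {K : ℕ}
    (hP : ∀ q : ℕ → ℝ≥0∞, ∑' k, q k ≤ 4 * (C * N ^ 2) →
      N + ∑ k ∈ Finset.range K, scale (s - n / 2) k * q k ^ (1 / 2 : ℝ) ≤ P * N)
    {Ω : Set (EuclideanSpace ℝ (Fin n))} (hΩ : Ω ⊆ D) :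
    eLpNorm v 2 (volume.restrict Ω) ≤
      smallConst n r C s * (P * volume Ω ^ (1 / 2 : ℝ) + scale s K) * N := by
  obtain ⟨Γ, hΓ, hΓN, hae⟩ := h
  set T : EuclideanSpace ℝ (Fin n) → ℝ≥0∞ := fun x => ∑' k, scale (s - n / 2) (k + K) *
      (∫⁻ y in D ∩ shell r x (k + K), Γ y) ^ (1 / 2 : ℝ) with hT
  set S := ∑' k, scale s k with hS
  set B := ballConst n r with hB
  set V := volume Ω with hV
  have hTm : Measurable T := Measurable.tsum fun k =>
    ((measurable_setLIntegral_shell D r (k + K) hΓ).pow_const _).const_mul _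
  have h1 : ∀ᵐ x ∂volume.restrict Ω, ‖v x‖ₑ ^ 2 ≤ C ^ 2 * (2 * (P * N) ^ 2 + 2 * T x ^ 2) := by
    filter_upwards [ae_mono (Measure.restrict_mono hΩ le_rfl) hae] with x hx
    have h2 : ‖v x‖ₑ ≤ C * (P * N + T x) := by
      refine hx.trans ?_
      rw [← ENNReal.summable.sum_add_tsum_nat_add' (k := K), ← add_assoc]
      gcongr
      exact hP _ ((tsum_setLIntegral_shell_le hr hΓ x).trans (by gcongr))
    calc ‖v x‖ₑ ^ 2 ≤ (C * (P * N + T x)) ^ 2 := by gcongr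
      _ = C ^ 2 * (P * N + T x) ^ 2 := by ring
      _ ≤ C ^ 2 * (2 * (P * N) ^ 2 + 2 * T x ^ 2) := by
        gcongr
        exact add_sq_le_two_mul_sq _ _
  have h3 : ∫⁻ x in D, T x ^ 2 ≤ (scale s K * S * B) ^ 2 * (C * N ^ 2) :=
    (lintegral_sq_tail_le hr.le hΓ K).trans (by gcongr)
  have h4 : ∫⁻ x in Ω, ‖v x‖ₑ ^ 2 ≤
      C ^ 2 * (2 * (P * N) ^ 2 * V + 2 * ((scale s K * S * B) ^ 2 * (C * N ^ 2))) := by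
    refine (lintegral_mono_ae h1).trans ?_
    rw [lintegral_const_mul _ (by fun_prop), lintegral_add_left measurable_const,
      lintegral_const, Measure.restrict_apply_univ, lintegral_const_mul _ (by fun_prop)]
    exact mul_le_mul_right (add_le_add le_rfl
      (mul_le_mul_right ((lintegral_mono_set hΩ).trans h3) _)) _
  apply le_of_sq_le_sq
  rw [← lintegral_enorm_sq_eq]
  refine h4.trans ?_
  set V' := V ^ (1 / 2 : ℝ) with hV'
  set C' := C ^ (1 / 2 : ℝ) with hC'
  have hVV : V = V' ^ 2 := (rpow_half_sq V).symm
  have hCC : C * N ^ 2 = C' ^ 2 * N ^ 2 := by rw [hC', rpow_half_sq]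
  rw [hVV, hCC]
  have h5 : P * V' + S * B * C' * scale s K ≤ (1 + S * B * C') * (P * V' + scale s K) := by
    calc _ ≤ (P * V' + S * B * C' * scale s K) + (scale s K + S * B * C' * (P * V')) :=
          le_self_add
      _ = _ := by ring
  -- The added terms complete the square of the sum of head and tail.
  calc _ ≤ C ^ 2 * (2 * (P * N) ^ 2 * V' ^ 2 + 2 * ((scale s K * S * B) ^ 2 * (C' ^ 2 * N ^ 2)))
        + (C ^ 2 * 2 * (P * N * V') ^ 2 + C ^ 2 * 2 * (scale s K * S * B * C' * N) ^ 2 +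
          8 * C ^ 2 * (P * N * V' * (scale s K * S * B * C' * N))) := le_self_add
    _ = (2 * C * (P * V' + S * B * C' * scale s K) * N) ^ 2 := by ring
    _ ≤ (2 * C * ((1 + S * B * C') * (P * V' + scale s K)) * N) ^ 2 := by gcongr
    _ = _ := by rw [smallConst, ← mul_assoc (2 * C)]

/-- A pointwise bound of positive order gives an essential bound. -/
theorem PointwiseBound.exists_ae_le {C : ℝ≥0∞} (hC : C ≠ ⊤) {β : ℝ} (hβ : 0 < β) :
    ∃ C' : ℝ≥0∞, C' ≠ ⊤ ∧ ∀ (N : ℝ≥0∞) (v : EuclideanSpace ℝ (Fin n) → ℝ),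
      PointwiseBound D r C β N v → ∀ᵐ x ∂volume.restrict D, ‖v x‖ₑ ≤ C' * N := by
  refine ⟨C * (1 + (∑' k, scale β k) * (4 * C) ^ (1 / 2 : ℝ)), ?_, ?_⟩
  · have h1 := tsum_scale_ne_top hβ
    have h3 : (4 * C) ^ (1 / 2 : ℝ) ≠ ⊤ :=
      ENNReal.rpow_ne_top_of_nonneg (by norm_num) (by finiteness)
    finiteness
  · rintro N v ⟨Γ, hΓ, hΓN, hae⟩
    filter_upwards [hae] with x hx
    refine hx.trans ?_
    have h1 : ∀ k, (∫⁻ y in D ∩ shell r x k, Γ y) ^ (1 / 2 : ℝ) ≤ (4 * C) ^ (1 / 2 : ℝ) * N := by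
      intro k
      calc _ ≤ (4 * (C * N ^ 2)) ^ (1 / 2 : ℝ) := by
            refine ENNReal.rpow_le_rpow ?_ (by norm_num)
            refine (lintegral_mono_set Set.inter_subset_left).trans (hΓN.trans ?_)
            exact le_mul_of_one_le_left zero_le (by norm_num)
        _ = _ := by
            rw [← mul_assoc, ENNReal.mul_rpow_of_nonneg _ _ (by norm_num), sq_rpow_half]
    rw [mul_assoc, add_mul, one_mul, mul_assoc, ← ENNReal.tsum_mul_right]
    gcongr with k
    exact h1 k

/-- For a negative exponent the terms grow geometrically; read backwards from the top, the sum is a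
convergent series times `scale β K`. -/
theorem sum_range_scale_le {β : ℝ} (hβ : β < 0) (K : ℕ) :
    ∑ k ∈ Finset.range K, scale β k ≤ (∑' j, scale (-β) j) * scale β K := by
  rw [← Finset.sum_range_reflect, mul_comm, ← ENNReal.tsum_mul_left]
  refine (Finset.sum_le_sum fun j hj => ?_).trans (ENNReal.sum_le_tsum (Finset.range K))
  have h1 : K = (K - 1 - j) + j + 1 := by have := Finset.mem_range.1 hj; omega
  have h2 : scale β K * scale (-β) j = scale β (K - 1 - j) * scale β 1 := by
    conv_lhs => rw [h1, scale_add, scale_add]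
    calc _ = scale β (K - 1 - j) * scale β 1 * (scale β j * scale (-β) j) := by ring
      _ = _ := by rw [scale_mul, add_neg_cancel, scale_zero_left, mul_one]
  rw [h2]
  refine le_mul_of_one_le_right zero_le ?_
  rw [← scale_zero_left 1]
  exact scale_anti hβ.le 1

theorem one_le_scale {β : ℝ} (hβ : β ≤ 0) (K : ℕ) : 1 ≤ scale β K := by
  rw [← scale_zero_left K]
  exact scale_anti hβ K

end Summation

/-! ### Estimates on small sets: subcritical, critical, supercritical -/

section SmallSets

variable {n : ℕ} {D : Set (EuclideanSpace ℝ (Fin n))} {s : ℝ}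

theorem eta_of_ne (hs : s ≠ n / 2) (a : ℝ) : eta n s a = 1 := by
  unfold eta
  rw [if_neg fun h => hs h.2]

theorem eta_of_eq (hn : n = 2 ∨ n = 3) (hs : s = n / 2) (a : ℝ) :
    eta n s a = |Real.log a| ^ (1 / 2 : ℝ) := by
  unfold eta
  rw [if_pos ⟨hn, hs⟩]

/-- Above 1 by monotonicity; below 1 from `|log a| ≥ 1 - a ≥ δ ≥ log (1 + δ)`. -/
theorem log_one_add_le_abs_log {δ a : ℝ} (hδ : 0 < δ) (ha : 0 < a) (h : δ ≤ |a - 1|) :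
    Real.log (1 + δ) ≤ |Real.log a| := by
  rcases le_abs.1 h with h1 | h1
  · exact (Real.log_le_log (by linarith) (by linarith)).trans (le_abs_self _)
  · have h2 := Real.log_le_sub_one_of_pos ha
    have h3 := Real.log_le_sub_one_of_pos (x := 1 + δ) (by linarith)
    have h4 := neg_le_abs (Real.log a)
    linarith

theorem MemSobolev.eLpNorm_le (hDo : IsOpen D) {v : EuclideanSpace ℝ (Fin n) → ℝ}
    (h : MemSobolev D s v) {Ω : Set (EuclideanSpace ℝ (Fin n))} (hΩ : Ω ⊆ D) :
    eLpNorm v 2 (volume.restrict Ω) ≤ sobolevNorm D s v := by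
  obtain ⟨w, hwm, hw, hw2, -⟩ := h.exists_measurable_weakDeriv hDo (α := 0) (by simp)
  refine (eLpNorm_mono_measure _ (Measure.restrict_mono hΩ le_rfl)).trans ?_
  rw [eLpNorm_congr_ae (hw.ae_eq_of_zero hDo)]
  apply le_of_sq_le_sq
  rwa [← lintegral_enorm_sq_eq]

/-- Each number in `(0, 1)` is comparable to the `n`-th power of a dyadic scale. -/
theorem exists_scale_near (hn : n ≠ 0) {a : ℝ} (ha : 0 < a) (ha1 : a < 1) :
    ∃ K : ℕ, (K : ℝ) * Real.log 2 * n ≤ |Real.log a| ∧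
      (∀ t : ℝ, 0 < t → scale t K ≤ ENNReal.ofReal (2 ^ t) * ENNReal.ofReal (a ^ (t / n))) ∧
      ∀ t : ℝ, t ≤ 0 → scale t K ≤ ENNReal.ofReal (a ^ (t / n)) := by
  have hn0 : (0 : ℝ) < n := Nat.cast_pos.2 (Nat.pos_of_ne_zero hn)
  set ρ := a ^ (1 / (n : ℝ)) with hρ
  have hρ0 : 0 < ρ := Real.rpow_pos_of_pos ha _
  have hρ1 : ρ ≤ 1 := Real.rpow_le_one ha.le ha1.le (by positivity)
  -- Thus `ρ ≤ 2^{-K} < 2 ρ`. For a positive exponent the upper bound is used and costs `2^t`; for a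
  -- nonpositive one the lower bound costs nothing.
  obtain ⟨K, hK1, hK2⟩ := exists_nat_pow_near_of_lt_one hρ0 hρ1 (y := 1 / 2) (by norm_num)
    (by norm_num)
  have hpow : ∀ t : ℝ, ρ ^ t = a ^ (t / n) := by
    intro t
    rw [hρ, ← Real.rpow_mul ha.le]; congr 1; ring
  have hscale : ∀ t : ℝ, scale t K = ENNReal.ofReal (((1 / 2 : ℝ) ^ K) ^ t) := by
    intro t
    rw [two_inv_pow_eq, ← Real.rpow_mul zero_le_two, scale]
    congr 2; ring
  refine ⟨K, ?_, fun t ht => ?_, fun t ht => ?_⟩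
  · have h1 := Real.log_le_log hρ0 hK2
    rw [hρ, Real.log_rpow ha, Real.log_pow, one_div (2 : ℝ), Real.log_inv] at h1
    have h2 : Real.log a ≤ (K * -Real.log 2) * n := by
      rwa [one_div, inv_mul_le_iff₀ hn0, mul_comm] at h1
    have h3 := neg_le_abs (Real.log a)
    linarith
  · rw [hscale, ← ENNReal.ofReal_mul (by positivity), ← hpow, ← Real.mul_rpow zero_le_two hρ0.le]
    apply ENNReal.ofReal_le_ofReal
    refine Real.rpow_le_rpow (by positivity) ?_ ht.le
    rw [pow_succ] at hK1
    linarith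
  · rw [hscale, ← hpow]
    exact ENNReal.ofReal_le_ofReal (Real.rpow_le_rpow_of_nonpos hρ0 hK2 ht)

theorem volume_rpow_half_eq (hDb : Bornology.IsBounded D)
    {Ω : Set (EuclideanSpace ℝ (Fin n))} (hΩ : Ω ⊆ D) :
    volume Ω ^ (1 / 2 : ℝ) = ENNReal.ofReal (volume.real Ω ^ (1 / 2 : ℝ)) := by
  rw [← ENNReal.ofReal_rpow_of_nonneg measureReal_nonneg (by norm_num),
    ofReal_measureReal (hDb.subset hΩ).measure_lt_top.ne]

/-- The estimate on small sets below the critical order. -/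
theorem exists_eLpNorm_le_of_lt (hn : n ≠ 0) (hDo : IsOpen D) (hDb : Bornology.IsBounded D)
    (hDc : ConeCondition D) (hs : 0 < s) (hs2 : s ≤ 2) (hsn : s < n / 2) :
    ∃ C : ℝ≥0∞, C ≠ ⊤ ∧ ∀ v : EuclideanSpace ℝ (Fin n) → ℝ, MemSobolev D s v →
      ∀ Ω ⊆ D, 0 < volume.real Ω → eLpNorm v 2 (volume.restrict Ω) ≤
        C * ENNReal.ofReal (volume.real Ω ^ (s / n)) * sobolevNorm D s v := by
  obtain ⟨r, C, hr, hC, hbound⟩ := exists_pointwiseBound hDo hDb hDc hs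
  have hn0 : (0 : ℝ) < n := Nat.cast_pos.2 (Nat.pos_of_ne_zero hn)
  have hβ : s - n / 2 < 0 := by linarith
  set c := (∑' j, scale (-(s - n / 2)) j) * (4 * C) ^ (1 / 2 : ℝ) with hc
  have hc' : c ≠ ⊤ := by
    have h1 := tsum_scale_ne_top (a := -(s - n / 2)) (by linarith)
    have h3 : (4 * C) ^ (1 / 2 : ℝ) ≠ ⊤ :=
      ENNReal.rpow_ne_top_of_nonneg (by norm_num) (by finiteness)
    finiteness
  refine ⟨1 + smallConst n r C s * (1 + c + ENNReal.ofReal (2 ^ s)), ?_, fun v hv Ω hΩ h0 => ?_⟩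
  · have := smallConst_ne_top n r hC hs
    finiteness
  set a := volume.real Ω with ha
  set N := sobolevNorm D s v with hN
  rcases le_or_gt 1 a with h1 | h1
  · refine (hv.eLpNorm_le hDo hΩ).trans (le_mul_of_one_le_left zero_le ?_)
    refine one_le_mul le_self_add ?_
    rw [ENNReal.one_le_ofReal]
    exact Real.one_le_rpow h1 (by positivity)
  · obtain ⟨K, -, hK1, hK2⟩ := exists_scale_near hn h0 h1
    have hb := hbound v hv
    rw [min_eq_left hs2] at hb
    have hP : ∀ q : ℕ → ℝ≥0∞, ∑' k, q k ≤ 4 * (C * N ^ 2) →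
        N + ∑ k ∈ Finset.range K, scale (s - n / 2) k * q k ^ (1 / 2 : ℝ) ≤
          ((1 + c) * scale (s - n / 2) K) * N := by
      intro q hq
      have h2 : ∀ k, q k ^ (1 / 2 : ℝ) ≤ (4 * C) ^ (1 / 2 : ℝ) * N := by
        intro k
        refine (ENNReal.rpow_le_rpow ((ENNReal.le_tsum k).trans hq) (by norm_num)).trans_eq ?_
        rw [← mul_assoc, ENNReal.mul_rpow_of_nonneg _ _ (by norm_num), sq_rpow_half]
      calc _ ≤ N + ∑ k ∈ Finset.range K, scale (s - n / 2) k * ((4 * C) ^ (1 / 2 : ℝ) * N) := by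
            gcongr with k
            exact h2 k
        _ = N + (∑ k ∈ Finset.range K, scale (s - n / 2) k) * ((4 * C) ^ (1 / 2 : ℝ) * N) := by
            rw [Finset.sum_mul]
        _ ≤ scale (s - n / 2) K * N + ((∑' j, scale (-(s - n / 2)) j) * scale (s - n / 2) K) *
            ((4 * C) ^ (1 / 2 : ℝ) * N) := by
            gcongr
            · exact le_mul_of_one_le_left zero_le (one_le_scale hβ.le K)
            · exact sum_range_scale_le hβ K
        _ = _ := by rw [hc]; ring
    refine (hb.eLpNorm_le hr hP hΩ).trans ?_
    gcongr ?_ * _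
    rw [volume_rpow_half_eq hDb hΩ]
    -- The head balances the tail: `(s - n/2)/n + 1/2 = s/n`.
    have h3 : scale (s - n / 2) K * ENNReal.ofReal (a ^ (1 / 2 : ℝ)) ≤
        ENNReal.ofReal (a ^ (s / n)) := by
      calc _ ≤ ENNReal.ofReal (a ^ ((s - n / 2) / n)) * ENNReal.ofReal (a ^ (1 / 2 : ℝ)) := by
            gcongr
            exact hK2 _ hβ.le
        _ = _ := by
            rw [← ENNReal.ofReal_mul (by positivity), ← Real.rpow_add h0]
            congr 2; field_simp; ring
    calc _ = smallConst n r C s * ((1 + c) * (scale (s - n / 2) K *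
          ENNReal.ofReal (a ^ (1 / 2 : ℝ))) + scale s K) := by rw [← ha]; ring
      _ ≤ smallConst n r C s * ((1 + c) * ENNReal.ofReal (a ^ (s / n)) +
          ENNReal.ofReal (2 ^ s) * ENNReal.ofReal (a ^ (s / n))) := by
          gcongr
          exact hK1 s hs
      _ = smallConst n r C s * (1 + c + ENNReal.ofReal (2 ^ s)) *
          ENNReal.ofReal (a ^ (s / n)) := by ring
      _ ≤ _ := by gcongr; exact le_add_self

theorem sum_rpow_half_le (q : ℕ → ℝ≥0∞) (K : ℕ) :
    ∑ k ∈ Finset.range K, q k ^ (1 / 2 : ℝ) ≤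
      (K : ℝ≥0∞) ^ (1 / 2 : ℝ) * (∑' k, q k) ^ (1 / 2 : ℝ) := by
  have h := ENNReal.inner_le_Lp_mul_Lq (Finset.range K) (fun _ => 1) (fun k => q k ^ (1 / 2 : ℝ))
    Real.HolderConjugate.two_two
  simp only [one_mul, one_pow, Finset.sum_const, Finset.card_range, nsmul_eq_mul, mul_one,
    ENNReal.rpow_ofNat, rpow_half_sq] at h
  refine h.trans ?_
  gcongr
  exact ENNReal.sum_le_tsum _

/-- The estimate on small sets at the critical order. -/
theorem exists_eLpNorm_le_of_eq (hn : n = 2 ∨ n = 3) (hDo : IsOpen D)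
    (hDb : Bornology.IsBounded D) (hDc : ConeCondition D) (hs : 0 < s) (hsn : s = n / 2)
    {δ : ℝ} (hδ : 0 < δ) :
    ∃ C : ℝ≥0∞, C ≠ ⊤ ∧ ∀ v : EuclideanSpace ℝ (Fin n) → ℝ, MemSobolev D s v →
      ∀ Ω ⊆ D, 0 < volume.real Ω → δ ≤ |volume.real Ω - 1| →
        eLpNorm v 2 (volume.restrict Ω) ≤
          C * ENNReal.ofReal (volume.real Ω ^ (1 / 2 : ℝ) *
            |Real.log (volume.real Ω)| ^ (1 / 2 : ℝ)) * sobolevNorm D s v := by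
  obtain ⟨r, C, hr, hC, hbound⟩ := exists_pointwiseBound hDo hDb hDc hs
  have hnz : n ≠ 0 := by omega
  have hn2 : (2 : ℝ) ≤ n := by exact_mod_cast (by omega : 2 ≤ n)
  have hn3 : (n : ℝ) ≤ 3 := by exact_mod_cast (by omega : n ≤ 3)
  have hs2 : s ≤ 2 := by linarith
  set L := Real.log (1 + δ) with hL
  have hL0 : 0 < L := Real.log_pos (by linarith)
  set g := ENNReal.ofReal ((L ^ (1 / 2 : ℝ))⁻¹) with hg
  set d := (4 * C) ^ (1 / 2 : ℝ) with hd
  have hd' : d ≠ ⊤ := ENNReal.rpow_ne_top_of_nonneg (by norm_num) (by finiteness)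
  refine ⟨g + smallConst n r C s * (g + d + ENNReal.ofReal (2 ^ s) * g), ?_,
    fun v hv Ω hΩ h0 hΩδ => ?_⟩
  · have := smallConst_ne_top n r hC hs
    finiteness
  set a := volume.real Ω with ha
  set N := sobolevNorm D s v with hN
  have hlog : L ≤ |Real.log a| := log_one_add_le_abs_log hδ h0 hΩδ
  set e := ENNReal.ofReal (|Real.log a| ^ (1 / 2 : ℝ)) with he
  -- The logarithmic factor is bounded below thanks to δ, so terms that lack it can be absorbed at
  -- the cost of `g`.
  have hge : 1 ≤ g * e := by
    rw [hg, he, ← ENNReal.ofReal_mul (by positivity), ENNReal.one_le_ofReal,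
      le_inv_mul_iff₀ (by positivity), mul_one]
    exact Real.rpow_le_rpow hL0.le hlog (by norm_num)
  rw [ENNReal.ofReal_mul (by positivity), ← he]
  rcases le_or_gt 1 a with h1 | h1
  · refine (hv.eLpNorm_le hDo hΩ).trans (le_mul_of_one_le_left zero_le ?_)
    have h2 : 1 ≤ ENNReal.ofReal (a ^ (1 / 2 : ℝ)) := by
      rw [ENNReal.one_le_ofReal]
      exact Real.one_le_rpow h1 (by positivity)
    calc 1 ≤ ENNReal.ofReal (a ^ (1 / 2 : ℝ)) * (g * e) := one_le_mul h2 hge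
      _ = g * (ENNReal.ofReal (a ^ (1 / 2 : ℝ)) * e) := by ring
      _ ≤ _ := by gcongr; exact le_self_add
  · obtain ⟨K, hK0, hK1, -⟩ := exists_scale_near hnz h0 h1
    have hb := hbound v hv
    rw [min_eq_left hs2] at hb
    have hKe : (K : ℝ≥0∞) ^ (1 / 2 : ℝ) ≤ e := by
      rw [he, ← ENNReal.ofReal_rpow_of_nonneg (abs_nonneg _) (by norm_num)]
      refine ENNReal.rpow_le_rpow ?_ (by norm_num)
      rw [← ENNReal.ofReal_natCast]
      apply ENNReal.ofReal_le_ofReal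
      -- True from `n = 2` on, so that K is at most `|log a|` with no further constant.
      have h2 : 1 ≤ Real.log 2 * n := by nlinarith [Real.log_two_gt_d9]
      calc (K : ℝ) ≤ K * (Real.log 2 * n) := le_mul_of_one_le_right K.cast_nonneg h2
        _ ≤ _ := by rwa [← mul_assoc]
    have hP : ∀ q : ℕ → ℝ≥0∞, ∑' k, q k ≤ 4 * (C * N ^ 2) →
        N + ∑ k ∈ Finset.range K, scale (s - n / 2) k * q k ^ (1 / 2 : ℝ) ≤
          ((g + d) * e) * N := by
      intro q hq
      have h2 : (∑' k, q k) ^ (1 / 2 : ℝ) ≤ d * N := by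
        refine (ENNReal.rpow_le_rpow hq (by norm_num)).trans_eq ?_
        rw [← mul_assoc, ENNReal.mul_rpow_of_nonneg _ _ (by norm_num), sq_rpow_half]
      have h3 : s - n / 2 = 0 := by linarith
      simp only [h3, scale_zero_left, one_mul]
      calc _ ≤ (g * e) * N + e * (d * N) := by
            refine add_le_add (le_mul_of_one_le_left zero_le hge)
              ((sum_rpow_half_le q K).trans ?_)
            gcongr
        _ = _ := by ring
    refine (hb.eLpNorm_le hr hP hΩ).trans ?_
    gcongr ?_ * _
    rw [volume_rpow_half_eq hDb hΩ, ← ha]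
    have h4 : scale s K ≤ ENNReal.ofReal (2 ^ s) * g * e * ENNReal.ofReal (a ^ (1 / 2 : ℝ)) := by
      refine (hK1 s hs).trans ?_
      have h5 : s / n = 1 / 2 := by rw [hsn]; field_simp
      rw [h5, mul_assoc _ g e]
      gcongr
      exact le_mul_of_one_le_right zero_le hge
    calc _ ≤ smallConst n r C s * ((g + d) * e * ENNReal.ofReal (a ^ (1 / 2 : ℝ)) +
          ENNReal.ofReal (2 ^ s) * g * e * ENNReal.ofReal (a ^ (1 / 2 : ℝ))) := by gcongr
      _ = smallConst n r C s * (g + d + ENNReal.ofReal (2 ^ s) * g) *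
          (ENNReal.ofReal (a ^ (1 / 2 : ℝ)) * e) := by ring
      _ ≤ _ := by gcongr; exact le_add_self

/-- The estimate on small sets above the critical order. -/
theorem exists_eLpNorm_le_of_gt (hn : n ≤ 3) (hDo : IsOpen D) (hDb : Bornology.IsBounded D)
    (hDc : ConeCondition D) (hs : 0 < s) (hsn : n / 2 < s) :
    ∃ C : ℝ≥0∞, C ≠ ⊤ ∧ ∀ v : EuclideanSpace ℝ (Fin n) → ℝ, MemSobolev D s v →
      ∀ Ω ⊆ D, eLpNorm v 2 (volume.restrict Ω) ≤
        C * ENNReal.ofReal (volume.real Ω ^ (1 / 2 : ℝ)) * sobolevNorm D s v := by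
  obtain ⟨r, C, hr, hC, hbound⟩ := exists_pointwiseBound hDo hDb hDc hs
  have hn3 : (n : ℝ) ≤ 3 := by exact_mod_cast hn
  -- Here the dimension enters: `n / 2 ≤ 3 / 2 < 2`, so two derivatives already give boundedness.
  have hβ : 0 < min s 2 - n / 2 := sub_pos.2 (lt_min hsn (by linarith))
  obtain ⟨C', hC', h⟩ := PointwiseBound.exists_ae_le (D := D) (r := r) hC hβ
  refine ⟨C', hC', fun v hv Ω hΩ => ?_⟩
  have hae := ae_mono (Measure.restrict_mono hΩ le_rfl) (h _ v (hbound v hv))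
  rw [← volume_rpow_half_eq hDb hΩ]
  apply le_of_sq_le_sq
  rw [← lintegral_enorm_sq_eq]
  calc ∫⁻ x in Ω, ‖v x‖ₑ ^ 2 ≤ ∫⁻ x in Ω, (C' * sobolevNorm D s v) ^ 2 :=
        lintegral_mono_ae (by filter_upwards [hae] with x hx; gcongr)
    _ = (C' * sobolevNorm D s v) ^ 2 * volume Ω := by
        rw [lintegral_const, Measure.restrict_apply_univ]
    _ = _ := by rw [mul_right_comm, mul_pow _ (volume Ω ^ (1 / 2 : ℝ)), rpow_half_sq]

end SmallSets

end SmallDomain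

/-! ### The three regimes combined -/

theorem lemma3p2 (n : ℕ) (hn : n = 2 ∨ n = 3)
    (D : Set (EuclideanSpace ℝ (Fin n))) (hDo : IsOpen D) (hDb : Bornology.IsBounded D)
    (hDc : SmallDomain.ConeCondition D) (s : ℝ) (hs : 0 < s) (δ : ℝ) (hδ : 0 < δ) :
    ∃ C : ℝ, 0 < C ∧
      ∀ v : EuclideanSpace ℝ (Fin n) → ℝ, SmallDomain.MemSobolev D s v →
        ∀ Ω : Set (EuclideanSpace ℝ (Fin n)), Ω ⊆ D → MeasurableSet Ω →
          (s = n / 2 → δ ≤ |volume.real Ω - 1|) →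
            eLpNorm v 2 (volume.restrict Ω) ≤
              ENNReal.ofReal (C * volume.real Ω ^ SmallDomain.theta n s *
                SmallDomain.eta n s (volume.real Ω)) * SmallDomain.sobolevNorm D s v := by
  have hn2 : (2 : ℝ) ≤ n := by exact_mod_cast (by omega : 2 ≤ n)
  have hn3 : (n : ℝ) ≤ 3 := by exact_mod_cast (by omega : n ≤ 3)
  suffices h : ∃ C : ℝ≥0∞, C ≠ ⊤ ∧ ∀ v : EuclideanSpace ℝ (Fin n) → ℝ,
      SmallDomain.MemSobolev D s v → ∀ Ω ⊆ D, 0 < volume.real Ω →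
        (s = n / 2 → δ ≤ |volume.real Ω - 1|) → eLpNorm v 2 (volume.restrict Ω) ≤
          C * ENNReal.ofReal (volume.real Ω ^ SmallDomain.theta n s *
            SmallDomain.eta n s (volume.real Ω)) * SmallDomain.sobolevNorm D s v by
    obtain ⟨C, hC, h⟩ := h
    refine ⟨C.toReal + 1, by positivity, fun v hv Ω hΩ _ hΩδ => ?_⟩
    -- On a null set the left-hand side vanishes; the logarithm is needed only for positive measure.
    rcases (measureReal_nonneg (μ := volume) (s := Ω)).eq_or_lt with h0 | h0
    · have h1 : volume Ω = 0 := by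
        rwa [eq_comm, measureReal_eq_zero_iff (hDb.subset hΩ).measure_lt_top.ne] at h0
      rw [Measure.restrict_eq_zero.2 h1, eLpNorm_measure_zero]
      exact zero_le
    · refine (h v hv Ω hΩ h0 hΩδ).trans ?_
      rw [mul_assoc (C.toReal + 1),
        ENNReal.ofReal_mul (p := C.toReal + 1) (by positivity)]
      gcongr
      rw [ENNReal.ofReal_add ENNReal.toReal_nonneg zero_le_one, ENNReal.ofReal_toReal hC]
      exact le_self_add
  rcases lt_trichotomy s (n / 2) with hlt | heq | hgt
  · obtain ⟨C, hC, h⟩ := SmallDomain.exists_eLpNorm_le_of_lt (by omega) hDo hDb hDc hs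
      (by linarith) hlt
    refine ⟨C, hC, fun v hv Ω hΩ h0 _ => ?_⟩
    have hθ : SmallDomain.theta n s = s / n :=
      min_eq_left ((div_le_iff₀ (by linarith)).2 (by linarith))
    rw [hθ, SmallDomain.eta_of_ne hlt.ne, mul_one]
    exact h v hv Ω hΩ h0
  · obtain ⟨C, hC, h⟩ := SmallDomain.exists_eLpNorm_le_of_eq hn hDo hDb hDc hs heq hδ
    refine ⟨C, hC, fun v hv Ω hΩ h0 hΩδ => ?_⟩
    have hθ : SmallDomain.theta n s = 1 / 2 :=
      min_eq_right ((le_div_iff₀ (by linarith)).2 (by linarith))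
    rw [hθ, SmallDomain.eta_of_eq hn heq]
    exact h v hv Ω hΩ h0 (hΩδ heq)
  · obtain ⟨C, hC, h⟩ := SmallDomain.exists_eLpNorm_le_of_gt (by omega) hDo hDb hDc hs hgt
    refine ⟨C, hC, fun v hv Ω hΩ h0 _ => ?_⟩
    have hθ : SmallDomain.theta n s = 1 / 2 :=
      min_eq_right ((le_div_iff₀ (by linarith)).2 (by linarith))
    rw [hθ, SmallDomain.eta_of_ne hgt.ne', mul_one]
    exact h v hv Ω hΩ
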